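/- Let $J\ge 0$ be an integer and let $\mathfrak b=(\mathfrak b_1,\dots,\mathfrak b_J)\in\mathbb R^J$ satisfy $\sum_{j=1}^J\mathfrak b_j=J$ and $\sum_{i\in I}\mathfrak b_i\neq 0$ for every nonempty $I\subset\{1,\dots,J\}$. For $Z=(z_1,\dots,z_J)\in\mathbb C^J$ and $|z|>\max_j|z_j|$, expand each factor by the binomial theorem and write $$\prod_{j=1}^J (z-z_j)^{\mathfrak b_j}=z^J\prod_{j=1}^J\Bigl(1-\frac{z_j}{z}\Bigr)^{\mathfrak b_j}=\sum_{k=0}^\infty d_k(Z)\,z^{J-k}.$$ Define $\mathcal F=\mathcal F_{\mathfrak b}:\mathbb C^J\to\mathbb C^J$ by $\mathcal F(Z)=A=(A_1,\dots,A_J)$, $A_\ell=d_\ell(Z)$. Let $\Delta=\{Z: z_i=z_j\text{ for some }i\ne j\}$ be the union of the partial diagonals and let $\mathcal S_{\mathfrak b}=\mathcal F(\Delta)$ be the weighted discriminant locus. Then $\mathcal S_{\mathfrak b}$ is a proper algebraic subvariety of $\mathbb C^J$ (possibly empty), $\mathcal F$ is a proper holomorphic map, and: (i) $\mathcal F$ is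 ramified exactly along $\Delta$, i.e. the set of points at which $\mathcal F$ is not a local biholomorphism equals $\Delta$; the image of this set is $\mathcal S_{\mathfrak b}$. (ii) $\mathcal F^{-1}(\mathbb C^J\setminus\mathcal S_{\mathfrak b})$ consists of $J$-tuples of pairwise distinct points, and $\mathcal F:\mathcal F^{-1}(\mathbb C^J\setminus\mathcal S_{\mathfrak b})\to\mathbb C^J\setminus\mathcal S_{\mathfrak b}$ is a $J!$-sheeted covering map. (iii) Let $0\in\Omega\subset\mathbb C^J$ and let $A\mapsto(z_1(A),\dots,z_J(A))$ be any right inverse of $\mathcal F$ on $\Omega$, i.e. $\mathcal F(z_1(A),\dots,z_J(A))=A$ for $A\in\Omega$ (for instance on a neighbourhood of $0$, or a local branch of $\mathcal F^{-1}$ on a set with $0$ in its closure, extended by $0\mapsto 0$). Then for every $z=|z|e^{i\theta}\ne 0$ the function $$v(A;z)=\sum_{j=1}^J\mathfrak b_j\log|z-z_j(A)|$$ is (real) differentiable at $A=0$ relative to $\Omega$, and, writing $A_\ell=e'_\ell+i\,e''_\ell$, it has a differential there with components $$\frac{\partial v}{\partial e'_\ell}(0)=\cos(\ell\theta)\,|z|^{-\ell},\qquad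 \frac{\partial v}{\partial e''_\ell}(0)=\sin(\ell\theta)\,|z|^{-\ell},\qquad \ell=1,\dots,J.$$ In particular, if $\Omega$ is a neighbourhood of $0$, then $v(\cdot\,;z)$ is differentiable at $0$ in the usual sense with these partial derivatives. -/

import Mathlib

noncomputable section

namespace WeightedCluster

variable {J : ℕ}

/-- The degenerate weights: those for which the weights of some nonempty subcluster sum to zero. -/
def degenerateWeights (J : ℕ) : Set (Fin J → ℝ) :=
  ⋃ I : {I : Finset (Fin J) // I.Nonempty}, {b | ∑ i ∈ I.1, b i = 0}

/-- The series `∏ i (1 - z_i w) ^ (b i)` in the variable `w = 1 / z`, where each factor is expanded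
by the binomial theorem. When the weights sum to `J`, this is
`z ^ (-J) * ∏ i (z - z_i) ^ (b i) = ∑ k, d_k z ^ (-k)`. -/
def expansion (b : Fin J → ℝ) (Z : Fin J → ℂ) : PowerSeries ℂ :=
  ∏ i, PowerSeries.rescale (-Z i) (PowerSeries.binomialSeries ℂ (b i))

/-- The map `(z_1, …, z_J) ↦ (A_1, …, A_J) = (d_1, …, d_J)`; the index `ℓ : Fin J` stands for the
integer `ℓ + 1`. -/
def coeffMap (b : Fin J → ℝ) (Z : Fin J → ℂ) : Fin J → ℂ :=
  fun ℓ => PowerSeries.coeff ((ℓ : ℕ) + 1) (expansion b Z)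

/-- The union of the partial diagonals. -/
def partialDiagonals (J : ℕ) : Set (Fin J → ℂ) :=
  {Z | ∃ i j, i ≠ j ∧ Z i = Z j}

/-- The weighted discriminant locus. -/
def discriminantLocus (b : Fin J → ℝ) : Set (Fin J → ℂ) :=
  coeffMap b '' partialDiagonals J

/-- `F` restricts to a biholomorphism from an open neighbourhood of `Z` onto an open set. -/
def IsLocalBiholomorphAt (F : (Fin J → ℂ) → (Fin J → ℂ)) (Z : Fin J → ℂ) : Prop :=
  ∃ e : OpenPartialHomeomorph (Fin J → ℂ) (Fin J → ℂ),
    Z ∈ e.source ∧ Set.EqOn F e e.source ∧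
      DifferentiableOn ℂ e e.source ∧ DifferentiableOn ℂ e.symm e.target

/-- The points at which `F` is ramified, that is, not a local biholomorphism. -/
def ramificationLocus (F : (Fin J → ℂ) → (Fin J → ℂ)) : Set (Fin J → ℂ) :=
  {Z | ¬ IsLocalBiholomorphAt F Z}

/-- The function `∑ j, b_j log |z - z_j|`. -/
def logPotential (b : Fin J → ℝ) (Z : Fin J → ℂ) (z : ℂ) : ℝ :=
  ∑ j, b j * Real.log ‖z - Z j‖

end WeightedCluster

end

/-!
By Newton's identities, `coeffMap b` is the map of weighted power sums `∑ j, b j * Z j ^ k`,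
`1 ≤ k ≤ J`, followed by a polynomial automorphism of `ℂ ^ J`. For nondegenerate weights the power
sums vanish only at `0`: group equal coordinates. Since they are homogeneous, the map is proper. The
same argument over valuation rings makes `ℂ[z]` integral over the polynomials pulled back along
`coeffMap b`, so the image of the diagonals is algebraic. The Jacobian determinant of the power sums
is a multiple of the Vandermonde determinant, which locates the ramification.

A proper local homeomorphism with finite fibres is a covering. To count its sheets, let the weights
vary over all complex nondegenerate ones. The pairs of weights and unramified values contain the
complement of a hypersurface, which is connected and dense, so the number of sheets is the one for
the weights `(1, …, 1)`, namely `J !` by Vieta's formulas.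

Near `A = 0` the potential is a constant plus the real part of a linear form in the power sums, with
an error of order `‖Z‖ ^ (J + 1)`. By homogeneity the norm of the power sums is at least a multiple
of `‖Z‖ ^ J`, so this error is negligible compared with `A`.
-/

noncomputable section

namespace WeightedCluster

/-! ### Weighted power sums -/

section PowerSums

open Polynomial

variable {ι : Type*} {R S : Type*} [CommRing R] [CommRing S]

/-- The weights of every nonempty subcluster have nonzero sum; over `ℝ` these are the weights
outside `degenerateWeights`. -/
def NondegenerateWeights (b : ι → R) : Prop :=
  ∀ I : Finset ι, I.Nonempty → ∑ i ∈ I, b i ≠ 0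

theorem NondegenerateWeights.map {b : ι → R} (hb : NondegenerateWeights b) {f : R →+* S}
    (hf : Function.Injective f) : NondegenerateWeights (f ∘ b) := by
  intro I hI h
  simp only [Function.comp_apply] at h
  rw [← map_sum, map_eq_zero_iff f hf] at h
  exact hb I hI h

theorem NondegenerateWeights.ofReal {b : ι → ℝ} (hb : NondegenerateWeights b) :
    NondegenerateWeights (Complex.ofReal ∘ b) :=
  hb.map (f := Complex.ofRealHom) Complex.ofReal_injective

theorem NondegenerateWeights.ne_zero {b : ι → R} (hb : NondegenerateWeights b) (i : ι) :
    b i ≠ 0 := by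
  simpa using hb {i} (Finset.singleton_nonempty i)

theorem nondegenerateWeights_of_notMem {J : ℕ} {b : Fin J → ℝ} (hb : b ∉ degenerateWeights J) :
    NondegenerateWeights b :=
  fun I hI h => hb (Set.mem_iUnion.2 ⟨⟨I, hI⟩, h⟩)

variable [Fintype ι]

/-- The weighted power sum `∑ i, b i * z i ^ n`. -/
def powerSum (b z : ι → R) (n : ℕ) : R :=
  ∑ i, b i * z i ^ n

theorem map_powerSum (f : R →+* S) (b z : ι → R) (n : ℕ) :
    f (powerSum b z n) = powerSum (f ∘ b) (f ∘ z) n := by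
  simp [powerSum]

theorem sum_mul_eval_eq_zero {b z : ι → R} {N : ℕ}
    (h : ∀ n ∈ Finset.Icc 1 N, powerSum b z n = 0) {q : R[X]} (hdeg : q.natDegree ≤ N)
    (h0 : q.coeff 0 = 0) : ∑ i, b i * q.eval (z i) = 0 := by
  simp_rw [eval_eq_sum_range, Finset.mul_sum]
  rw [Finset.sum_comm]
  refine Finset.sum_eq_zero fun n hn => ?_
  have hcoeff : q.coeff n * powerSum b z n = 0 := by
    rcases n.eq_zero_or_pos with rfl | hpos
    · rw [h0, zero_mul]
    · rw [h n (Finset.mem_Icc.2 ⟨hpos, (Finset.mem_range_succ_iff.1 hn).trans hdeg⟩), mul_zero]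
  rw [← hcoeff, powerSum, Finset.mul_sum]
  exact Finset.sum_congr rfl fun i _ => mul_left_comm _ _ _

/-- Testing against the polynomial that vanishes at `0` and at all values of `z` except one nonzero
value `v` isolates the total weight of the cluster `z = v`. -/
theorem eq_zero_of_powerSum_eq_zero [IsDomain R] {b z : ι → R} (hb : NondegenerateWeights b)
    (h : ∀ n ∈ Finset.Icc 1 (Fintype.card ι), powerSum b z n = 0) : z = 0 := by
  classical
  by_contra hz
  obtain ⟨i₀, hi₀⟩ := Function.ne_iff.1 hz
  let s := (Finset.univ.image z).erase (z i₀)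
  let q : R[X] := X * Lagrange.nodal s id
  have hdeg : q.natDegree ≤ Fintype.card ι := by
    calc q.natDegree ≤ 1 + s.card :=
          natDegree_mul_le_of_le natDegree_X_le Lagrange.natDegree_nodal.le
      _ = (Finset.univ.image z).card := by
          rw [add_comm]
          exact Finset.card_erase_add_one (Finset.mem_image_of_mem z (Finset.mem_univ i₀))
      _ ≤ Fintype.card ι := Finset.card_image_le
  have hq : ∀ i, z i ≠ z i₀ → q.eval (z i) = 0 := fun i hi => by
    have hmem : z i ∈ s := Finset.mem_erase.2 ⟨hi, Finset.mem_image_of_mem z (Finset.mem_univ i)⟩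
    have hnodal := Lagrange.eval_nodal_at_node (v := id) hmem
    rw [eval_mul, ← id_def (z i), hnodal, mul_zero]
  have hq₀ : q.eval (z i₀) ≠ 0 := by
    rw [eval_mul, eval_X]
    refine mul_ne_zero hi₀ (Lagrange.eval_nodal_not_at_node fun u hu => ?_)
    exact (Finset.ne_of_mem_erase hu).symm
  have hcluster : (∑ i with z i = z i₀, b i) * q.eval (z i₀) = 0 := by
    rw [← sum_mul_eval_eq_zero h hdeg (by simp [q]), Finset.sum_mul, Finset.sum_filter]
    refine Finset.sum_congr rfl fun i _ => ?_
    split_ifs with hi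
    · rw [hi]
    · rw [hq i hi, mul_zero]
  exact mul_ne_zero (hb _ ⟨i₀, by simp⟩) hq₀ hcluster

/-- The weighted power sums of degrees `1, …, J`; as in `coeffMap`, the index `k : Fin J` stands for
the degree `k + 1`. -/
def powerSumMap {J : ℕ} (b z : Fin J → R) (k : Fin J) : R :=
  powerSum b z (k + 1)

theorem map_powerSumMap {J : ℕ} (f : R →+* S) (b z : Fin J → R) :
    f ∘ powerSumMap b z = powerSumMap (f ∘ b) (f ∘ z) :=
  funext fun _ => map_powerSum f b z _

theorem eq_zero_of_powerSumMap_eq_zero [IsDomain R] {J : ℕ} {b z : Fin J → R}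
    (hb : NondegenerateWeights b) (h : powerSumMap b z = 0) : z = 0 := by
  refine eq_zero_of_powerSum_eq_zero hb fun n hn => ?_
  obtain ⟨h1, hJ⟩ := Finset.mem_Icc.1 hn
  rw [Fintype.card_fin] at hJ
  have hk := congrFun h ⟨n - 1, by omega⟩
  rwa [powerSumMap, Nat.sub_add_cancel h1] at hk

end PowerSums

/-! ### Newton's identities -/

section Newton

variable {R S : Type*} [CommRing R] [CommRing S]

/-- Newton's identity in degree `n + 1`, between coefficients `d 0 = 1, d 1, d 2, …` and power sums
`p 0, p 1, …`, where `p j` has degree `j + 1`. -/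
def NewtonIdentity (p d : ℕ → R) (n : ℕ) : Prop :=
  (n + 1) * d (n + 1) = -∑ j : Fin (n + 1), p j * d (n - j)

/-- The power sums determined by Newton's identities from the coefficients `1, d 1, d 2, …`; the
value of `d 0` is never read. -/
def newtonSum (d : ℕ → R) (n : ℕ) : R :=
  -((n + 1) * d (n + 1)) - ∑ j : Fin n, newtonSum d j * d (n - j)
termination_by n
decreasing_by exact j.2

theorem newtonIdentity_iff {p d : ℕ → R} (h0 : d 0 = 1) (n : ℕ) :
    NewtonIdentity p d n ↔ p n = -((n + 1) * d (n + 1)) - ∑ j : Fin n, p j * d (n - j) := by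
  rw [NewtonIdentity, Fin.sum_univ_castSucc]
  simp only [Fin.val_castSucc, Fin.val_last, tsub_self, h0, mul_one]
  constructor <;> intro h <;> linear_combination h

theorem newtonIdentity_newtonSum {d : ℕ → R} (h0 : d 0 = 1) (n : ℕ) :
    NewtonIdentity (newtonSum d) d n :=
  (newtonIdentity_iff h0 n).2 (by rw [newtonSum])

theorem newtonSum_eq {N : ℕ} {p d e : ℕ → R} (h0 : d 0 = 1) (hde : ∀ n < N, d (n + 1) = e (n + 1))
    (h : ∀ n < N, NewtonIdentity p d n) {n : ℕ} (hn : n < N) : newtonSum e n = p n := by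
  induction n using Nat.strong_induction_on with
  | _ n ih =>
    rw [(newtonIdentity_iff h0 n).1 (h n hn), newtonSum, hde n hn]
    congr 1
    refine Finset.sum_congr rfl fun j _ => ?_
    obtain ⟨m, hm⟩ : ∃ m, n - (j : ℕ) = m + 1 := ⟨n - j - 1, by omega⟩
    rw [ih j j.2 (by omega), hm, hde m (by omega)]

theorem map_newtonSum (f : R →+* S) (d : ℕ → R) (n : ℕ) :
    f (newtonSum d n) = newtonSum (f ∘ d) n := by
  induction n using Nat.strong_induction_on with
  | _ n ih =>
    rw [newtonSum, newtonSum]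
    simp only [map_sub, map_neg, map_mul, map_add, map_natCast, map_one, map_sum,
      Function.comp_apply]
    congr 1
    exact Finset.sum_congr rfl fun j _ => by rw [ih j j.2]

variable [Algebra ℚ R] [Algebra ℚ S]

/-- The coefficients determined by Newton's identities from the power sums `p 0, p 1, …`, that is,
those of `exp (-∑ k, p k * X ^ (k + 1) / (k + 1))`. -/
def newtonCoeff (p : ℕ → R) : ℕ → R
  | 0 => 1
  | n + 1 => -((n + 1 : ℚ)⁻¹ • ∑ j : Fin (n + 1), p j * newtonCoeff p (n - j))

theorem newtonIdentity_iff_eq_smul {p d : ℕ → R} (n : ℕ) :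
    NewtonIdentity p d n ↔
      d (n + 1) = -((n + 1 : ℚ)⁻¹ • ∑ j : Fin (n + 1), p j * d (n - j)) := by
  have hne : (n + 1 : ℚ) ≠ 0 := by exact_mod_cast n.succ_ne_zero
  have hsmul : ((n : R) + 1) * d (n + 1) = (n + 1 : ℚ) • d (n + 1) := by
    simp [Algebra.smul_def]
  rw [NewtonIdentity, hsmul, ← smul_neg, eq_inv_smul_iff₀ hne]

theorem newtonIdentity_newtonCoeff (p : ℕ → R) (n : ℕ) : NewtonIdentity p (newtonCoeff p) n :=
  (newtonIdentity_iff_eq_smul n).2 (by rw [newtonCoeff])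

theorem newtonCoeff_eq {N : ℕ} {p q d : ℕ → R} (h0 : d 0 = 1) (hpq : ∀ n < N, p n = q n)
    (h : ∀ n < N, NewtonIdentity p d n) {n : ℕ} (hn : n ≤ N) : newtonCoeff q n = d n := by
  induction n using Nat.strong_induction_on with
  | _ n ih =>
    cases n with
    | zero => rw [newtonCoeff, h0]
    | succ n =>
      rw [(newtonIdentity_iff_eq_smul n).1 (h n hn), newtonCoeff]
      congr 2
      refine Finset.sum_congr rfl fun j _ => ?_
      rw [ih (n - j) (by omega) (by omega), hpq j (by omega)]

theorem map_newtonCoeff (f : R →+* S) (p : ℕ → R) (n : ℕ) :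
    f (newtonCoeff p n) = newtonCoeff (f ∘ p) n := by
  induction n using Nat.strong_induction_on with
  | _ n ih =>
    cases n with
    | zero => rw [newtonCoeff, newtonCoeff, map_one]
    | succ n =>
      rw [newtonCoeff, newtonCoeff, map_neg, map_rat_smul, map_sum]
      congr 2
      refine Finset.sum_congr rfl fun j _ => ?_
      rw [map_mul, ih (n - j) (by omega), Function.comp_apply]

end Newton

section NewtonMap

variable {J : ℕ} {R S : Type*} [CommRing R] [CommRing S]

/-- The sequence `1, A 0, …, A (J - 1), 0, 0, …`. -/
def consOne (A : Fin J → R) : ℕ → R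
  | 0 => 1
  | n + 1 => Function.extend Fin.val A 0 n

/-- The power sums of degrees `1, …, J` that belong to the coefficients `1, A 0, …, A (J - 1)`. -/
def newtonInv (A : Fin J → R) (k : Fin J) : R :=
  newtonSum (consOne A) k

theorem map_newtonInv (f : R →+* S) (A : Fin J → R) : f ∘ newtonInv A = newtonInv (f ∘ A) := by
  have hcons : f ∘ consOne A = consOne (f ∘ A) := by
    funext n
    cases n with
    | zero => simp [consOne]
    | succ n =>
      exact (Function.apply_extend f _ _ _).trans (by simp [consOne])
  funext k
  rw [Function.comp_apply, newtonInv, newtonInv, map_newtonSum, hcons]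

theorem newtonInv_eq {p d : ℕ → R} (h0 : d 0 = 1) (h : ∀ n < J, NewtonIdentity p d n)
    (k : Fin J) : newtonInv (fun ℓ : Fin J => d (ℓ + 1)) k = p k := by
  refine newtonSum_eq h0 (fun n hn => ?_) h k.2
  exact (Fin.val_injective.extend_apply (fun k : Fin J => d (k + 1)) 0 ⟨n, hn⟩).symm

variable [Algebra ℚ R] [Algebra ℚ S]

/-- The coefficients in degrees `1, …, J` that belong to the power sums `p 0, …, p (J - 1)`. -/
def newtonMap (p : Fin J → R) (ℓ : Fin J) : R :=
  newtonCoeff (Function.extend Fin.val p 0) (ℓ + 1)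

theorem map_newtonMap (f : R →+* S) (p : Fin J → R) : f ∘ newtonMap p = newtonMap (f ∘ p) := by
  have hextend : f ∘ Function.extend Fin.val p 0 = Function.extend Fin.val (f ∘ p) 0 := by
    funext n
    exact (Function.apply_extend f _ _ _).trans (by simp)
  funext ℓ
  rw [Function.comp_apply, newtonMap, newtonMap, map_newtonCoeff, hextend]

theorem newtonMap_eq {p d : ℕ → R} (h0 : d 0 = 1) (h : ∀ n < J, NewtonIdentity p d n)
    (ℓ : Fin J) : newtonMap (fun k : Fin J => p k) ℓ = d (ℓ + 1) := by
  refine newtonCoeff_eq h0 (fun n hn => ?_) h ℓ.2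
  exact (Fin.val_injective.extend_apply (fun k : Fin J => p k) 0 ⟨n, hn⟩).symm

variable (J R) in
/-- Newton's identities identify tuples of power sums with tuples of coefficients. -/
def newtonEquiv : (Fin J → R) ≃ (Fin J → R) where
  toFun := newtonMap
  invFun := newtonInv
  left_inv p := by
    funext k
    refine (newtonInv_eq (newtonCoeff.eq_1 _)
      (fun n _ => newtonIdentity_newtonCoeff _ n) k).trans ?_
    exact Fin.val_injective.extend_apply p 0 k
  right_inv A := by
    funext ℓ
    refine (newtonMap_eq rfl
      (fun n _ => newtonIdentity_newtonSum (d := consOne A) rfl n) ℓ).trans ?_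
    exact Fin.val_injective.extend_apply A 0 ℓ

end NewtonMap

/-! ### Newton's identities for the coefficients of the expansion -/

section Expansion

open PowerSeries

theorem succ_mul_choose_succ {R : Type*} [CommRing R] [BinomialRing R] (r : R) (n : ℕ) :
    (n + 1) * Ring.choose r (n + 1) = (r - n) * Ring.choose r n := by
  simpa [mul_comm] using Ring.choose_smul_choose r n.le_succ

theorem one_sub_mul_derivative_binomialSeries {R A : Type*} [CommRing R] [BinomialRing R]
    [CommRing A] [Algebra R A] (r : R) (z : A) :
    (1 - C z * X) * d⁄dX A (rescale (-z) (binomialSeries A r)) =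
      -C (r • z) * rescale (-z) (binomialSeries A r) := by
  ext n
  have hchoose := congrArg (algebraMap R A) (succ_mul_choose_succ r n)
  simp only [map_mul, map_add, map_sub, map_natCast, map_one] at hchoose
  rw [sub_mul, one_mul, mul_assoc, map_sub, coeff_C_mul, neg_mul, map_neg, coeff_C_mul]
  cases n with
  | zero =>
    simp [coeff_derivative, coeff_rescale, Algebra.smul_def, mul_comm]
  | succ n =>
    simp only [coeff_succ_X_mul, coeff_derivative, coeff_rescale, binomialSeries_coeff,
      Algebra.smul_def, mul_one]
    push_cast at hchoose ⊢
    linear_combination (-z) ^ (n + 2) * hchoose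

theorem mk_pow_mul_one_sub {A : Type*} [CommRing A] (z : A) :
    mk (fun n => z ^ n) * (1 - C z * X) = 1 := by
  simpa [rescale_mk] using congrArg (rescale z) (mk_one_mul_one_sub_eq_one A)

theorem derivative_binomialSeries_factor {R A : Type*} [CommRing R] [BinomialRing R] [CommRing A]
    [Algebra R A] (r : R) (z : A) :
    d⁄dX A (rescale (-z) (binomialSeries A r)) =
      -mk (fun n => r • z ^ (n + 1)) * rescale (-z) (binomialSeries A r) := by
  have hmk : mk (fun n => r • z ^ (n + 1)) = mk (fun n => z ^ n) * C (r • z) := by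
    ext n
    simp only [Algebra.smul_def, coeff_mul_C, coeff_mk]
    ring
  rw [hmk, ← one_mul (d⁄dX A _), ← mk_pow_mul_one_sub z, mul_assoc,
    one_sub_mul_derivative_binomialSeries]
  ring

theorem derivation_prod_of_eq_mul {ι R A : Type*} [CommRing R] [CommRing A] [Algebra R A]
    (D : Derivation R A A) {f g : ι → A} (h : ∀ i, D (f i) = g i * f i) (s : Finset ι) :
    D (∏ i ∈ s, f i) = (∑ i ∈ s, g i) * ∏ i ∈ s, f i := by
  classical
  induction s using Finset.induction_on with
  | empty => simp
  | insert i s hi ih =>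
    rw [Finset.prod_insert hi, Finset.sum_insert hi, Derivation.leibniz, ih, h, smul_eq_mul,
      smul_eq_mul]
    ring

variable {J : ℕ}

theorem derivative_expansion (b : Fin J → ℝ) (Z : Fin J → ℂ) :
    d⁄dX ℂ (expansion b Z) =
      -mk (fun n => powerSum (Complex.ofReal ∘ b) Z (n + 1)) * expansion b Z := by
  have hmk : -mk (fun n => powerSum (Complex.ofReal ∘ b) Z (n + 1)) =
      ∑ i, -mk (fun n => b i • Z i ^ (n + 1)) := by
    ext n
    simp [powerSum]
  rw [hmk]
  exact derivation_prod_of_eq_mul _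
    (fun i => derivative_binomialSeries_factor (b i) (Z i)) Finset.univ

theorem coeff_zero_expansion (b : Fin J → ℝ) (Z : Fin J → ℂ) : coeff 0 (expansion b Z) = 1 := by
  rw [coeff_zero_eq_constantCoeff_apply, expansion, map_prod]
  refine Finset.prod_eq_one fun i _ => ?_
  rw [← coeff_zero_eq_constantCoeff_apply, coeff_rescale]
  simp

theorem newtonIdentity_expansion (b : Fin J → ℝ) (Z : Fin J → ℂ) (n : ℕ) :
    NewtonIdentity (fun k => powerSum (Complex.ofReal ∘ b) Z (k + 1))
      (fun k => coeff k (expansion b Z)) n := by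
  have h := congrArg (coeff n) (derivative_expansion b Z)
  rw [coeff_derivative, neg_mul, map_neg, coeff_mul,
    Finset.Nat.sum_antidiagonal_eq_sum_range_succ_mk] at h
  simp only [coeff_mk] at h
  rw [NewtonIdentity, mul_comm, h]
  exact congrArg _ (Finset.sum_range _)

theorem coeffMap_eq_newtonEquiv (b : Fin J → ℝ) (Z : Fin J → ℂ) :
    coeffMap b Z = newtonEquiv J ℂ (powerSumMap (Complex.ofReal ∘ b) Z) :=
  funext fun ℓ => (newtonMap_eq (coeff_zero_expansion b Z)
    (fun n _ => newtonIdentity_expansion b Z n) ℓ).symm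

theorem newtonInv_coeffMap (b : Fin J → ℝ) (Z : Fin J → ℂ) :
    newtonInv (coeffMap b Z) = powerSumMap (Complex.ofReal ∘ b) Z := by
  rw [coeffMap_eq_newtonEquiv]
  exact (newtonEquiv J ℂ).symm_apply_apply _

end Expansion

/-! ### Integrality and the discriminant locus -/

section Integrality

variable {J : ℕ} {K : Type*} [Field K]

theorem exists_mul_mem_valuationSubring {ι : Type*} [Finite ι] (V : ValuationSubring K) {Z : ι → K}
    (hZ : ∃ i, Z i ∉ V) :
    ∃ t ∈ IsLocalRing.maximalIdeal V, ∃ u : ι → V, (∀ j, (u j : K) = t * Z j) ∧ ∃ m, u m = 1 := by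
  obtain ⟨i, hi⟩ := hZ
  have : Nonempty ι := ⟨i⟩
  obtain ⟨m, hm⟩ := Finite.exists_max fun j => V.valuation (Z j)
  have hZm : 1 < V.valuation (Z m) := by
    rw [← V.valuation_le_one_iff, not_le] at hi
    exact hi.trans_le (hm i)
  have hm0 : Z m ≠ 0 := fun h0 => by simp [h0] at hZm
  have ht : V.valuation (Z m)⁻¹ < 1 := by
    rw [map_inv₀]
    exact inv_lt_one_of_one_lt₀ hZm
  have hu (j : ι) : (Z m)⁻¹ * Z j ∈ V := by
    rw [← V.valuation_le_one_iff, mul_comm, ← div_eq_mul_inv, map_div₀]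
    exact div_le_one_of_le₀ (hm j) zero_le
  let t : V := ⟨(Z m)⁻¹, (V.valuation_le_one_iff _).1 ht.le⟩
  exact ⟨t, (V.valuation_lt_one_iff t).2 ht, fun j => ⟨(Z m)⁻¹ * Z j, hu j⟩, fun j => rfl, m,
    Subtype.ext (inv_mul_cancel₀ hm0)⟩

/-- Divide `Z` by an entry of largest valuation and reduce: the power sums vanish in the residue
field, while one entry is `1`. -/
theorem mem_valuationSubring_of_powerSumMap_mem (V : ValuationSubring K) {b : Fin J → V}
    (hb : NondegenerateWeights (IsLocalRing.residue V ∘ b)) {Z : Fin J → K}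
    (h : ∀ k, powerSumMap (V.subtype ∘ b) Z k ∈ V) (i : Fin J) : Z i ∈ V := by
  by_contra hi
  obtain ⟨t, ht, u, hu, m, hm⟩ := exists_mul_mem_valuationSubring V ⟨i, hi⟩
  have hpow (k : Fin J) : powerSumMap b u k = t ^ ((k : ℕ) + 1) * ⟨_, h k⟩ := by
    refine Subtype.ext ((congrFun (map_powerSumMap V.subtype b u) k).trans ?_)
    change _ = (t : K) ^ ((k : ℕ) + 1) * _
    simp only [powerSumMap, powerSum, Finset.mul_sum]
    refine Finset.sum_congr rfl fun j _ => ?_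
    rw [show (V.subtype ∘ u) j = t * Z j from hu j, mul_pow, mul_left_comm]
  have hresidue : powerSumMap (IsLocalRing.residue V ∘ b) (IsLocalRing.residue V ∘ u) = 0 := by
    rw [← map_powerSumMap]
    funext k
    rw [Function.comp_apply, hpow, map_mul, map_pow, (IsLocalRing.residue_eq_zero_iff t).2 ht,
      zero_pow k.val.succ_ne_zero, zero_mul, Pi.zero_apply]
  have hzero := congrFun (eq_zero_of_powerSumMap_eq_zero hb hresidue) m
  rw [Function.comp_apply, hm, map_one] at hzero
  exact one_ne_zero hzero

theorem isIntegral_of_forall_mem_valuationSubring {R : Type*} [CommRing R] [Algebra R K] {x : K}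
    (h : ∀ V : ValuationSubring K, (∀ r, algebraMap R K r ∈ V) → x ∈ V) : IsIntegral R x := by
  let S : Subring K := (⊥ : Subalgebra R K).toSubring
  have hx : x ∈ (integralClosure (Subring.closure (S : Set K)) K).toSubring := by
    rw [← iInf_valuationSubring_superset, Subring.mem_iInf]
    exact fun V => h V.1 fun r => V.2 (Subalgebra.algebraMap_mem ⊥ r)
  rw [Subring.closure_eq] at hx
  have : Algebra.IsIntegral R (⊥ : Subalgebra R K) :=
    Algebra.isIntegral_of_surjective fun ⟨_, r, hr⟩ => ⟨r, Subtype.ext hr⟩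
  exact isIntegral_trans (A := (⊥ : Subalgebra R K)) x hx

theorem isIntegralElem_of_forall_mem_valuationSubring {R A : Type*} [CommRing R] [CommRing A]
    [Algebra A K] [FaithfulSMul A K] {φ : R →+* A} {x : A}
    (h : ∀ V : ValuationSubring K, (∀ r, algebraMap A K (φ r) ∈ V) → algebraMap A K x ∈ V) :
    φ.IsIntegralElem x := by
  algebraize [φ, (algebraMap A K).comp φ]
  have : IsScalarTower R A K := .of_algebraMap_eq fun _ => rfl
  exact (isIntegral_algebraMap_iff (FaithfulSMul.algebraMap_injective A K)).1
    (isIntegral_of_forall_mem_valuationSubring h)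

open MvPolynomial

variable {k : Type*} [Field k] [Algebra ℚ k]

/-- The polynomials giving the components of `coeffMap`, for weights in a field. -/
def coeffPoly (b : Fin J → k) : Fin J → MvPolynomial (Fin J) k :=
  newtonEquiv J _ (powerSumMap (C ∘ b) X)

theorem aeval_coeffPoly (b : Fin J → ℝ) (Z : Fin J → ℂ) (ℓ : Fin J) :
    aeval Z (coeffPoly (Complex.ofReal ∘ b) ℓ) = coeffMap b Z ℓ := by
  rw [coeffMap_eq_newtonEquiv]
  refine (congrFun (map_newtonMap (aeval (R := ℂ) Z : MvPolynomial (Fin J) ℂ →+* ℂ) _) ℓ).trans ?_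
  rw [map_powerSumMap]
  congr 2 <;> funext i <;> simp

theorem isIntegral_aeval_coeffPoly {b : Fin J → k} (hb : NondegenerateWeights b) :
    (aeval (R := k) (coeffPoly b)).toRingHom.IsIntegral := by
  set φ := aeval (R := k) (coeffPoly b)
  have hX (i : Fin J) : φ.toRingHom.IsIntegralElem (X i) := by
    refine isIntegralElem_of_forall_mem_valuationSubring
      (K := FractionRing (MvPolynomial (Fin J) k)) fun V hV => ?_
    let ι := algebraMap (MvPolynomial (Fin J) k) (FractionRing (MvPolynomial (Fin J) k))
    have hC (c : k) : ι (C c) ∈ V := by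
      exact φ.commutes c ▸ hV (C c)
    let c : k →+* V := (ι.comp C).codRestrict V.toSubring hC
    have hcoeff (ℓ : Fin J) : ι (coeffPoly b ℓ) ∈ V := by
      exact aeval_X (R := k) (coeffPoly b) ℓ ▸ hV (X ℓ)
    have hpow : powerSumMap (V.subtype ∘ c ∘ b) (ι ∘ X) =
        V.subtype ∘ newtonInv fun ℓ => (⟨_, hcoeff ℓ⟩ : V) := by
      calc powerSumMap (V.subtype ∘ c ∘ b) (ι ∘ X)
          = ι ∘ powerSumMap (C ∘ b) X := (map_powerSumMap ι (C ∘ b) X).symm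
        _ = ι ∘ newtonInv (coeffPoly b) :=
            congrArg _ ((newtonEquiv J _).symm_apply_apply _).symm
        _ = _ := by rw [map_newtonInv, map_newtonInv]; rfl
    refine mem_valuationSubring_of_powerSumMap_mem V (b := c ∘ b) (Z := ι ∘ X)
      (hb.map ((IsLocalRing.residue V).comp c).injective) (fun k => ?_) i
    rw [hpow]
    exact (newtonInv (fun ℓ => (⟨_, hcoeff ℓ⟩ : V)) k).2
  intro p
  induction p using MvPolynomial.induction_on with
  | C c =>
    rw [← algebraMap_eq, ← φ.commutes c]
    exact φ.toRingHom.isIntegralElem_map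
  | add p q hp hq => exact hp.add _ hq
  | mul_X p i hp => exact hp.mul _ (hX i)

end Integrality

section Discriminant

open MvPolynomial

variable {J : ℕ} {k σ τ : Type*} [Field k]

theorem exists_isMaximal_comap_eq {R S : Type*} [CommRing R] [CommRing S] {φ : R →+* S}
    (hφ : φ.IsIntegral) {I : Ideal S} {P : Ideal R} [P.IsMaximal] (h : I.comap φ ≤ P) :
    ∃ Q ≥ I, Q.IsMaximal ∧ Q.comap φ = P := by
  algebraize [φ]
  obtain ⟨Q, hQI, hQ, rfl⟩ := Ideal.exists_ideal_over_prime_of_isIntegral P I h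
  exact ⟨Q, hQI, Ideal.isMaximal_of_isIntegral_of_isMaximal_comap (R := R) Q ‹_›, rfl⟩

theorem comap_ne_bot_of_isIntegral {R S : Type*} [CommRing R] [CommRing S] [Nontrivial R]
    [IsDomain S] {φ : R →+* S} (hφ : φ.IsIntegral) {I : Ideal S} (hI : I ≠ ⊥) :
    I.comap φ ≠ ⊥ := by
  algebraize [φ]
  obtain ⟨x, hxI, hx⟩ := Submodule.exists_mem_ne_zero_of_ne_bot hI
  exact Ideal.comap_ne_bot_of_integral_mem hx hxI (hφ x)

theorem mem_zeroLocus_iff_le_vanishingIdeal {I : Ideal (MvPolynomial σ k)} {Z : σ → k} :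
    Z ∈ zeroLocus k I ↔ I ≤ vanishingIdeal k {Z} := by
  rw [← le_zeroLocus_iff_le_vanishingIdeal, Set.singleton_subset_iff]

theorem vanishingIdeal_singleton_comap (f : σ → MvPolynomial τ k) (Z : τ → k) :
    (vanishingIdeal k {Z}).comap (aeval (R := k) f).toRingHom =
      vanishingIdeal k {fun s => aeval Z (f s)} := by
  ext p
  rw [Ideal.mem_comap, mem_vanishingIdeal_singleton_iff, mem_vanishingIdeal_singleton_iff]
  have hcomp : (aeval Z).comp (aeval (R := k) f) = aeval fun s => aeval Z (f s) := by
    ext s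
    simp
  rw [← hcomp]
  rfl

theorem vanishingIdeal_singleton_injective :
    Function.Injective fun Z : σ → k => vanishingIdeal k {Z} := by
  intro Z W h
  funext s
  have hmem : X s - C (Z s) ∈ vanishingIdeal k {W} := by
    rw [← show vanishingIdeal k {Z} = vanishingIdeal k {W} from h,
      mem_vanishingIdeal_singleton_iff]
    simp
  rw [mem_vanishingIdeal_singleton_iff] at hmem
  simpa [sub_eq_zero, eq_comm] using hmem

theorem image_zeroLocus_of_isIntegral [IsAlgClosed k] [Finite σ] [Finite τ]
    {f : σ → MvPolynomial τ k} (hf : (aeval (R := k) f).toRingHom.IsIntegral)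
    (I : Ideal (MvPolynomial τ k)) :
    (fun Z s => aeval Z (f s)) '' zeroLocus k I =
      zeroLocus k (I.comap (aeval (R := k) f).toRingHom) := by
  ext A
  rw [mem_zeroLocus_iff_le_vanishingIdeal]
  constructor
  · rintro ⟨Z, hZ, rfl⟩
    rw [← vanishingIdeal_singleton_comap]
    exact Ideal.comap_mono (mem_zeroLocus_iff_le_vanishingIdeal.1 hZ)
  · intro hA
    have := isMaximal_iff_eq_vanishingIdeal_singleton.2 ⟨A, rfl⟩
    obtain ⟨Q, hQI, hQ, hQA⟩ := exists_isMaximal_comap_eq hf hA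
    obtain ⟨Z, rfl⟩ := isMaximal_iff_eq_vanishingIdeal_singleton.1 hQ
    rw [vanishingIdeal_singleton_comap] at hQA
    exact ⟨Z, mem_zeroLocus_iff_le_vanishingIdeal.2 hQI, vanishingIdeal_singleton_injective hQA⟩

theorem partialDiagonals_eq_zeroLocus :
    partialDiagonals J =
      zeroLocus ℂ (Ideal.span {(Matrix.vandermonde (X (R := ℂ) (σ := Fin J))).det}) := by
  ext Z
  have hdet : aeval Z (Matrix.vandermonde (X (R := ℂ))).det = (Matrix.vandermonde Z).det := by
    rw [AlgHom.map_det]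
    congr 1
    ext i j
    simp [Matrix.vandermonde_apply]
  simp only [zeroLocus_span, Set.mem_singleton_iff, forall_eq, Set.mem_ofPred_eq, hdet,
    Matrix.det_vandermonde_eq_zero_iff, partialDiagonals, and_comm]

theorem exists_discriminantLocus_eq_zeroLocus {b : Fin J → ℝ} (hb : NondegenerateWeights b) :
    ∃ I : Ideal (MvPolynomial (Fin J) ℂ), I ≠ ⊥ ∧ discriminantLocus b = zeroLocus ℂ I := by
  have hint := isIntegral_aeval_coeffPoly hb.ofReal
  have hspan : Ideal.span {(Matrix.vandermonde (X (R := ℂ) (σ := Fin J))).det} ≠ ⊥ := by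
    rw [Ne, Ideal.span_singleton_eq_bot]
    exact Matrix.det_vandermonde_ne_zero_iff.2 X_injective
  refine ⟨_, comap_ne_bot_of_isIntegral hint hspan, ?_⟩
  have hcoeff : coeffMap b = fun Z ℓ => aeval Z (coeffPoly (Complex.ofReal ∘ b) ℓ) :=
    funext₂ fun Z ℓ => (aeval_coeffPoly b Z ℓ).symm
  rw [discriminantLocus, partialDiagonals_eq_zeroLocus, hcoeff, image_zeroLocus_of_isIntegral hint]

end Discriminant

/-! ### Ramification along the diagonals -/

section Ramification

open Function Topology

variable {𝕜 : Type*} [RCLike 𝕜] {E : Type*} [NormedAddCommGroup E] [NormedSpace 𝕜 E]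
  [FiniteDimensional 𝕜 E]

theorem isInvertible_of_injective {f : E →L[𝕜] E} (hf : Injective f) : f.IsInvertible := by
  have := FiniteDimensional.complete 𝕜 E
  exact ⟨(LinearEquiv.ofInjectiveEndo (f : E →ₗ[𝕜] E) hf).toContinuousLinearEquiv, rfl⟩

theorem exists_openPartialHomeomorph_of_injective_fderiv {f : E → E} (hf : ContDiff 𝕜 1 f) {x : E}
    (hinj : Injective (fderiv 𝕜 f x)) :
    ∃ e : OpenPartialHomeomorph E E, x ∈ e.source ∧ f = e := by
  have := FiniteDimensional.complete 𝕜 E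
  obtain ⟨f', hf'⟩ := isInvertible_of_injective hinj
  have hfx : HasFDerivAt f (f' : E →L[𝕜] E) x :=
    hf' ▸ (hf.differentiable one_ne_zero x).hasFDerivAt
  exact ⟨hf.contDiffAt.toOpenPartialHomeomorph f hfx one_ne_zero,
    hf.contDiffAt.mem_toOpenPartialHomeomorph_source hfx one_ne_zero, rfl⟩

theorem isOpen_setOf_injective_fderiv {f : E → E} (hf : ContDiff 𝕜 1 f) :
    IsOpen {x | Injective (fderiv 𝕜 f x)} := by
  have := FiniteDimensional.complete 𝕜 E
  have hpre : {x | Injective (fderiv 𝕜 f x)} =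
      fderiv 𝕜 f ⁻¹' Set.range ((↑) : (E ≃L[𝕜] E) → E →L[𝕜] E) :=
    Set.ext fun _ => ⟨isInvertible_of_injective, ContinuousLinearMap.IsInvertible.injective⟩
  rw [hpre]
  exact ContinuousLinearEquiv.isOpen.preimage (hf.continuous_fderiv one_ne_zero)

variable {J : ℕ}

theorem IsLocalBiholomorphAt.injective_fderiv {F : (Fin J → ℂ) → Fin J → ℂ} {Z : Fin J → ℂ}
    (h : IsLocalBiholomorphAt F Z) : Injective (fderiv ℂ F Z) := by
  obtain ⟨e, hZ, hFe, hd, hds⟩ := h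
  have hF : F =ᶠ[𝓝 Z] e := hFe.eventuallyEq_of_mem (e.open_source.mem_nhds hZ)
  have hdZ : DifferentiableAt ℂ e Z := hd.differentiableAt (e.open_source.mem_nhds hZ)
  have hdsZ : DifferentiableAt ℂ e.symm (e Z) :=
    hds.differentiableAt (e.open_target.mem_nhds (e.map_source hZ))
  have hid : (fderiv ℂ e.symm (e Z)).comp (fderiv ℂ e Z) = ContinuousLinearMap.id ℂ _ :=
    ((hdsZ.hasFDerivAt.comp Z hdZ.hasFDerivAt).congr_of_eventuallyEq
      ((e.eventually_left_inverse hZ).mono fun _ h => h.symm)).unique (hasFDerivAt_id Z)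
  rw [hF.fderiv_eq]
  exact LeftInverse.injective fun v => DFunLike.congr_fun hid v

theorem isLocalBiholomorphAt_iff {F : (Fin J → ℂ) → Fin J → ℂ} (hF : ContDiff ℂ 1 F)
    {Z : Fin J → ℂ} : IsLocalBiholomorphAt F Z ↔ Injective (fderiv ℂ F Z) := by
  refine ⟨IsLocalBiholomorphAt.injective_fderiv, fun hinj => ?_⟩
  obtain ⟨e, hZ, rfl⟩ := exists_openPartialHomeomorph_of_injective_fderiv hF hinj
  let e' := e.restrOpen _ (isOpen_setOf_injective_fderiv hF)
  refine ⟨e', ⟨hZ, hinj⟩, fun _ _ => rfl, (hF.differentiable one_ne_zero).differentiableOn,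
    fun A hA => ?_⟩
  obtain ⟨f', hf'⟩ := isInvertible_of_injective (e'.map_target hA).2
  have hd : HasFDerivAt e (f' : (Fin J → ℂ) →L[ℂ] Fin J → ℂ) (e'.symm A) :=
    hf' ▸ (hF.differentiable one_ne_zero _).hasFDerivAt
  exact (e'.hasFDerivAt_symm hA hd).differentiableAt.differentiableWithinAt

theorem contDiff_aeval {m : WithTop ℕ∞} {ι κ : Type*} [Fintype ι] [Fintype κ]
    (q : κ → MvPolynomial ι ℂ) :
    ContDiff ℂ m fun (x : ι → ℂ) k => MvPolynomial.aeval x (q k) :=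
  contDiff_pi' fun k =>
    (AnalyticOnNhd.aeval_mvPolynomial (fun i => (ContinuousLinearMap.proj (R := ℂ)
      (φ := fun _ : ι => ℂ) i).analyticOnNhd Set.univ) (q k)).contDiff

theorem newtonMap_eq_aeval (p : Fin J → ℂ) :
    newtonMap p = fun ℓ => MvPolynomial.aeval p (newtonMap (MvPolynomial.X (R := ℂ)) ℓ) := by
  have hmap := map_newtonMap
    (MvPolynomial.aeval p : MvPolynomial (Fin J) ℂ →ₐ[ℂ] ℂ).toRingHom MvPolynomial.X
  have hX : MvPolynomial.aeval p ∘ MvPolynomial.X (R := ℂ) = p := funext (MvPolynomial.aeval_X p)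
  exact (hmap.trans (congrArg newtonMap hX)).symm

theorem newtonInv_eq_aeval (A : Fin J → ℂ) :
    newtonInv A = fun k => MvPolynomial.aeval A (newtonInv (MvPolynomial.X (R := ℂ)) k) := by
  have hmap := map_newtonInv
    (MvPolynomial.aeval A : MvPolynomial (Fin J) ℂ →ₐ[ℂ] ℂ).toRingHom MvPolynomial.X
  have hX : MvPolynomial.aeval A ∘ MvPolynomial.X (R := ℂ) = A := funext (MvPolynomial.aeval_X A)
  exact (hmap.trans (congrArg newtonInv hX)).symm

theorem contDiff_newtonMap {m : WithTop ℕ∞} :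
    ContDiff ℂ m (newtonMap : (Fin J → ℂ) → Fin J → ℂ) := by
  rw [funext newtonMap_eq_aeval]
  exact contDiff_aeval _

theorem contDiff_newtonInv {m : WithTop ℕ∞} :
    ContDiff ℂ m (newtonInv : (Fin J → ℂ) → Fin J → ℂ) := by
  rw [funext newtonInv_eq_aeval]
  exact contDiff_aeval _

variable (J) in
/-- `newtonEquiv` over `ℂ`, as a homeomorphism. -/
def newtonHomeomorph : (Fin J → ℂ) ≃ₜ (Fin J → ℂ) where
  toEquiv := newtonEquiv J ℂ
  continuous_toFun := (contDiff_newtonMap (m := 0)).continuous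
  continuous_invFun := (contDiff_newtonInv (m := 0)).continuous

theorem coeffMap_eq_comp (b : Fin J → ℝ) :
    coeffMap b = newtonHomeomorph J ∘ powerSumMap (Complex.ofReal ∘ b) :=
  funext (coeffMap_eq_newtonEquiv b)

theorem powerSumMap_eq_comp (b : Fin J → ℝ) :
    powerSumMap (Complex.ofReal ∘ b) = newtonInv ∘ coeffMap b :=
  (funext (newtonInv_coeffMap b)).symm

theorem contDiff_uncurry_powerSumMap {m : WithTop ℕ∞} :
    ContDiff 𝕜 m (uncurry (powerSumMap (R := 𝕜) (J := J))) := by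
  refine contDiff_pi' fun k => ?_
  simp only [uncurry_def, powerSumMap, powerSum]
  fun_prop

theorem contDiff_powerSumMap {m : WithTop ℕ∞} (b : Fin J → 𝕜) : ContDiff 𝕜 m (powerSumMap b) :=
  contDiff_uncurry_powerSumMap.comp (contDiff_const.prodMk contDiff_id)

theorem contDiff_coeffMap {m : WithTop ℕ∞} (b : Fin J → ℝ) : ContDiff ℂ m (coeffMap b) := by
  rw [coeffMap_eq_comp]
  exact contDiff_newtonMap.comp (contDiff_powerSumMap _)

open Matrix in
theorem fderiv_powerSumMap_apply (b z v : Fin J → 𝕜) (k : Fin J) :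
    fderiv 𝕜 (powerSumMap b) z v k = (k + 1) * ((b * v) ᵥ* vandermonde z) k := by
  have hd : HasFDerivAt (fun z : Fin J → 𝕜 => ∑ i, b i * z i ^ ((k : ℕ) + 1))
      (∑ i, b i • (((k : ℕ) + 1) • z i ^ (k : ℕ)) • ContinuousLinearMap.proj (R := 𝕜) i) z :=
    HasFDerivAt.fun_sum fun i _ =>
      ((hasFDerivAt_apply i z).pow ((k : ℕ) + 1)).const_mul (b i)
  have hk : fderiv 𝕜 (powerSumMap b) z v k = fderiv 𝕜 (fun z => powerSumMap b z k) z v :=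
    (DFunLike.congr_fun (fderiv_apply
      ((contDiff_powerSumMap b).differentiable one_ne_zero z) k) v).symm
  rw [hk]
  refine (DFunLike.congr_fun hd.fderiv v).trans ?_
  simp only [FunLike.coe_sum, Finset.sum_apply, vecMul, dotProduct,
    Finset.mul_sum, vandermonde_apply, Pi.mul_apply]
  refine Finset.sum_congr rfl fun i _ => ?_
  simp
  ring

open Matrix in
theorem injective_fderiv_powerSumMap_iff {b z : Fin J → 𝕜} (hb : ∀ i, b i ≠ 0) :
    Injective (fderiv 𝕜 (powerSumMap b) z) ↔ Injective z := by
  have hker (v : Fin J → 𝕜) :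
      fderiv 𝕜 (powerSumMap b) z v = 0 ↔ (b * v) ᵥ* vandermonde z = 0 := by
    have hne (k : Fin J) : (k : 𝕜) + 1 ≠ 0 := by exact_mod_cast (k : ℕ).succ_ne_zero
    simp only [funext_iff, fderiv_powerSumMap_apply, Pi.zero_apply, mul_eq_zero, hne, false_or]
  rw [injective_iff_map_eq_zero, ← det_vandermonde_ne_zero_iff, ← not_iff_not, not_not,
    ← exists_vecMul_eq_zero_iff]
  simp only [hker, not_forall]
  constructor
  · rintro ⟨v, hv, hv0⟩
    exact ⟨b * v, fun h => hv0 (funext fun i =>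
      (mul_eq_zero.1 (congrFun h i)).resolve_left (hb i)), hv⟩
  · rintro ⟨w, hw0, hw⟩
    have hbw : b * (b⁻¹ * w) = w := funext fun i => mul_inv_cancel_left₀ (hb i) (w i)
    exact ⟨b⁻¹ * w, by rwa [hbw], fun h => hw0 (by rw [← hbw, h, mul_zero])⟩

theorem injective_fderiv_coeffMap_iff {b : Fin J → ℝ} (hb : ∀ i, b i ≠ 0) {Z : Fin J → ℂ} :
    Injective (fderiv ℂ (coeffMap b) Z) ↔ Injective Z := by
  have hnewton : fderiv ℂ (coeffMap b) Z =
      (fderiv ℂ newtonMap (powerSumMap (Complex.ofReal ∘ b) Z)).comp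
        (fderiv ℂ (powerSumMap (Complex.ofReal ∘ b)) Z) := by
    rw [coeffMap_eq_comp]
    exact fderiv_comp Z (contDiff_newtonMap.differentiable one_ne_zero _)
      ((contDiff_powerSumMap _).differentiable one_ne_zero _)
  have hinv : fderiv ℂ (powerSumMap (Complex.ofReal ∘ b)) Z =
      (fderiv ℂ newtonInv (coeffMap b Z)).comp (fderiv ℂ (coeffMap b) Z) := by
    rw [powerSumMap_eq_comp]
    exact fderiv_comp Z (contDiff_newtonInv.differentiable one_ne_zero _)
      ((contDiff_coeffMap b).differentiable one_ne_zero _)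
  rw [← injective_fderiv_powerSumMap_iff (b := Complex.ofReal ∘ b)
    fun i => Complex.ofReal_ne_zero.2 (hb i)]
  constructor <;> intro h
  · rw [hnewton, ContinuousLinearMap.coe_comp] at h
    exact h.of_comp
  · rw [hinv, ContinuousLinearMap.coe_comp] at h
    exact h.of_comp

theorem notMem_partialDiagonals_iff {Z : Fin J → ℂ} : Z ∉ partialDiagonals J ↔ Injective Z := by
  simp only [partialDiagonals, Set.mem_ofPred_eq, not_exists, not_and, Injective]
  exact forall₂_congr fun i j => not_imp_not

theorem ramificationLocus_coeffMap {b : Fin J → ℝ} (hb : ∀ i, b i ≠ 0) :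
    ramificationLocus (coeffMap b) = partialDiagonals J := by
  ext Z
  rw [ramificationLocus, Set.mem_ofPred_eq, isLocalBiholomorphAt_iff (contDiff_coeffMap b),
    injective_fderiv_coeffMap_iff hb, ← notMem_partialDiagonals_iff, not_not]

end Ramification

/-! ### Properness -/

section Proper

open Function Filter Topology

variable {J : ℕ}

theorem powerSum_smul {ι R : Type*} [Fintype ι] [CommRing R] (b z : ι → R) (c : R) (n : ℕ) :
    powerSum b (c • z) n = c ^ n * powerSum b z n := by
  simp only [powerSum, Finset.mul_sum, Pi.smul_apply, smul_eq_mul, mul_pow]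
  exact Finset.sum_congr rfl fun i _ => mul_left_comm _ _ _

theorem exists_eventually_lt_norm_powerSumMap_sphere {b₀ : Fin J → ℂ}
    (hb : NondegenerateWeights b₀) :
    ∃ c > 0, ∀ᶠ b in 𝓝 b₀, ∀ Z ∈ Metric.sphere (0 : Fin J → ℂ) 1, c < ‖powerSumMap b Z‖ := by
  have hcont : Continuous fun q : (Fin J → ℂ) × (Fin J → ℂ) => ‖powerSumMap q.1 q.2‖ :=
    (contDiff_uncurry_powerSumMap (𝕜 := ℂ) (m := 0)).continuous.norm
  have hpos : ∀ Z ∈ Metric.sphere (0 : Fin J → ℂ) 1, 0 < ‖powerSumMap b₀ Z‖ := fun Z hZ =>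
    norm_pos_iff.2 fun h => ne_zero_of_mem_unit_sphere ⟨Z, hZ⟩ (eq_zero_of_powerSumMap_eq_zero hb h)
  have hsphere := isCompact_sphere (0 : Fin J → ℂ) 1
  obtain ⟨c, hc, hcZ⟩ := hsphere.exists_forall_le' (hcont.comp (.prodMk_right b₀)).continuousOn hpos
  exact ⟨c / 2, half_pos hc, hsphere.eventually_forall_of_forall_eventually
    (P := fun b Z => c / 2 < ‖powerSumMap b Z‖) fun Z hZ =>
      (hcont.tendsto (b₀, Z)).eventually (lt_mem_nhds ((half_lt_self hc).trans_le (hcZ Z hZ)))⟩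

theorem exists_eventually_mul_min_le_norm_powerSumMap {b₀ : Fin J → ℂ}
    (hb : NondegenerateWeights b₀) :
    ∃ c > 0, ∀ᶠ b in 𝓝 b₀, ∀ Z : Fin J → ℂ, c * min ‖Z‖ (‖Z‖ ^ J) ≤ ‖powerSumMap b Z‖ := by
  obtain ⟨c, hc, hev⟩ := exists_eventually_lt_norm_powerSumMap_sphere hb
  refine ⟨c, hc, hev.mono fun b hcb Z => ?_⟩
  rcases eq_or_ne Z 0 with rfl | hZ
  · simp
  have hZ0 : 0 < ‖Z‖ := norm_pos_iff.2 hZ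
  let u : Fin J → ℂ := (‖Z‖ : ℂ)⁻¹ • Z
  have hu : u ∈ Metric.sphere (0 : Fin J → ℂ) 1 := by
    simp [u, norm_smul, hZ0.ne']
  have hZu : (‖Z‖ : ℂ) • u = Z := smul_inv_smul₀ (by exact_mod_cast hZ0.ne') Z
  have hscale (k : Fin J) : powerSumMap b Z k = (‖Z‖ : ℂ) ^ ((k : ℕ) + 1) * powerSumMap b u k :=
    (congrArg (powerSumMap b · k) hZu).symm.trans (powerSum_smul b u _ _)
  obtain ⟨ℓ, hℓ⟩ : ∃ ℓ, c ≤ ‖powerSumMap b u ℓ‖ := by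
    by_contra! h
    exact lt_asymm (hcb u hu) ((pi_norm_lt_iff hc).2 h)
  have hpow : min ‖Z‖ (‖Z‖ ^ J) ≤ ‖Z‖ ^ ((ℓ : ℕ) + 1) := by
    rcases le_total ‖Z‖ 1 with h1 | h1
    · exact (min_le_right _ _).trans (pow_le_pow_of_le_one hZ0.le h1 ℓ.2)
    · exact (min_le_left _ _).trans (le_self_pow₀ h1 (Nat.succ_ne_zero _))
  calc c * min ‖Z‖ (‖Z‖ ^ J) ≤ ‖powerSumMap b u ℓ‖ * ‖Z‖ ^ ((ℓ : ℕ) + 1) := by gcongr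
    _ = ‖powerSumMap b Z ℓ‖ := by
      rw [hscale, norm_mul, norm_pow, Complex.norm_real, norm_norm, mul_comm]
    _ ≤ ‖powerSumMap b Z‖ := norm_le_pi_norm _ ℓ

theorem norm_le_max_of_mul_min_le {Z : Fin J → ℂ} {c M : ℝ} (hc : 0 < c)
    (h : c * min ‖Z‖ (‖Z‖ ^ J) ≤ M) : ‖Z‖ ≤ max 1 (M / c) := by
  rcases le_or_gt ‖Z‖ 1 with h1 | h1
  · exact h1.trans (le_max_left _ _)
  · have hJ : J ≠ 0 := by
      rintro rfl
      exact absurd h1 (by rw [Subsingleton.elim Z 0, norm_zero]; exact zero_le_one.not_gt)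
    rw [min_eq_left (le_self_pow₀ h1.le hJ)] at h
    exact ((le_div_iff₀' hc).2 h).trans (le_max_right _ _)

theorem isProperMap_powerSumMap {b : Fin J → ℂ} (hb : NondegenerateWeights b) :
    IsProperMap (powerSumMap b) := by
  have hcont : Continuous (powerSumMap b) := (contDiff_powerSumMap (m := 0) b).continuous
  obtain ⟨c, hc, hev⟩ := exists_eventually_mul_min_le_norm_powerSumMap hb
  refine isProperMap_iff_isCompact_preimage.2 ⟨hcont, fun K hK => ?_⟩
  obtain ⟨M, hM⟩ := hK.isBounded.exists_norm_le
  refine Metric.isCompact_of_isClosed_isBounded (hK.isClosed.preimage hcont)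
    ((Metric.isBounded_closedBall (x := 0) (r := max 1 (M / c))).subset fun Z hZ => ?_)
  exact mem_closedBall_zero_iff.2
    (norm_le_max_of_mul_min_le hc ((hev.self_of_nhds Z).trans (hM _ hZ)))

theorem isProperMap_coeffMap {b : Fin J → ℝ} (hb : NondegenerateWeights b) :
    IsProperMap (coeffMap b) := by
  rw [coeffMap_eq_comp]
  exact (newtonHomeomorph J).isProperMap.comp (isProperMap_powerSumMap hb.ofReal)

end Proper

/-! ### Coverings and the number of sheets -/

section Covering

open Filter Set Topology

variable {X Y : Type*} [TopologicalSpace X] [TopologicalSpace Y] {f : X → Y} {s t : Set Y}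

theorem finite_fiber_of_isLocalHomeomorphOn {y : Y} (hcompact : IsCompact (f ⁻¹' {y}))
    (hlocal : IsLocalHomeomorphOn f (f ⁻¹' {y})) : (f ⁻¹' {y}).Finite :=
  hcompact.finite <| IsDiscrete.of_openPartialHomeomorph f subset_rfl fun x hx =>
    (hlocal x hx).imp fun _ he => ⟨he.1, he.2.symm⟩

theorem isCoveringMapOn_of_isProperMap [T2Space X] (hf : IsProperMap f)
    (hlocal : IsLocalHomeomorphOn f (f ⁻¹' t)) : IsCoveringMapOn f t :=
  hf.isClosedMap.isCoveringMapOn_of_isLocalHomeomorphOn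
    (fun _ hy => finite_fiber_of_isLocalHomeomorphOn (hf.isCompact_preimage isCompact_singleton)
      (hlocal.mono (preimage_mono (singleton_subset_iff.2 hy)))) hlocal

theorem isLocalHomeomorphOn_restrictPreimage (hs : IsOpen s) (hf : Continuous f)
    (hlocal : IsLocalHomeomorphOn f (f ⁻¹' t)) :
    IsLocalHomeomorphOn (s.restrictPreimage f) (s.restrictPreimage f ⁻¹' (Subtype.val ⁻¹' t)) := by
  have hX : IsLocalHomeomorph (Subtype.val : f ⁻¹' s → X) :=
    (hs.preimage hf).isOpenEmbedding_subtypeVal.isLocalHomeomorph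
  exact IsLocalHomeomorphOn.of_comp_left
    (hlocal.comp hX.isLocalHomeomorphOn fun _ hx => hx)
    hs.isOpenEmbedding_subtypeVal.isLocalHomeomorph.isLocalHomeomorphOn
    fun _ _ => hf.restrictPreimage.continuousAt

theorem isProperMap_restrictPreimage [T2Space Y] (hf : Continuous f)
    (hK : ∀ y ∈ s, ∃ K, IsCompact K ∧ ∀ᶠ y' in 𝓝 y, f ⁻¹' {y'} ⊆ K) :
    IsProperMap (s.restrictPreimage f) := by
  refine isProperMap_iff_ultrafilter.2 ⟨hf.restrictPreimage, fun 𝒰 y hy => ?_⟩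
  have hfy : Tendsto f (𝒰.map Subtype.val) (𝓝 y) := (continuous_subtype_val.tendsto y).comp hy
  obtain ⟨K, hK, hyK⟩ := hK y y.2
  obtain ⟨x, -, hx⟩ := hK.ultrafilter_le_nhds (𝒰.map Subtype.val)
    (le_principal_iff.2 ((hfy.eventually hyK).mono fun _ h => h rfl))
  have hxy : f x = y := tendsto_nhds_unique ((hf.tendsto x).mono_left hx) hfy
  refine ⟨⟨x, mem_preimage.2 (hxy ▸ y.2)⟩, Subtype.ext hxy, ?_⟩
  rw [nhds_subtype]
  exact map_le_iff_le_comap.1 hx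

theorem isCoveringMapOn_of_isLocalHomeomorphOn [T2Space X] [T2Space Y] (hs : IsOpen s)
    (hf : Continuous f) (hK : ∀ y ∈ s, ∃ K, IsCompact K ∧ ∀ᶠ y' in 𝓝 y, f ⁻¹' {y'} ⊆ K)
    (hts : t ⊆ s) (hlocal : IsLocalHomeomorphOn f (f ⁻¹' t)) : IsCoveringMapOn f t := by
  have hcover : IsCoveringMapOn (s.restrictPreimage f) (Subtype.val ⁻¹' t) :=
    isCoveringMapOn_of_isProperMap (isProperMap_restrictPreimage hf hK)
      (isLocalHomeomorphOn_restrictPreimage hs hf hlocal)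
  intro y hy
  exact (((hcover ⟨y, hts hy⟩ hy).subtypeVal_comp _ hs).comp_subtypeVal _ hs (hs.preimage hf)
    (hts hy)).to_isEvenlyCovered_preimage

theorem ncard_fiber_eq_of_isEvenlyCovered {I : Type*} [TopologicalSpace I] {y : Y}
    (h : IsEvenlyCovered f y I) : (f ⁻¹' {y}).ncard = Nat.card I :=
  (Nat.card_coe_set_eq _).symm.trans (Nat.card_congr h.fiberHomeomorph.toEquiv.symm)

theorem ncard_fiber_eq_of_isCoveringMapOn (hf : IsCoveringMapOn f t) (ht : IsPreconnected t)
    {y y' : Y} (hy : y ∈ t) (hy' : y' ∈ t) : (f ⁻¹' {y}).ncard = (f ⁻¹' {y'}).ncard := by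
  refine ht.constant (f := fun y => (f ⁻¹' {y}).ncard) (fun y hy => ?_) hy hy'
  obtain ⟨_, U, hyU, hU, hfU, H, hH⟩ := hf y hy
  have hconst : ∀ y' ∈ U, Nat.card (f ⁻¹' {y}) = (f ⁻¹' {y'}).ncard := fun y' hy' =>
    (ncard_fiber_eq_of_isEvenlyCovered ⟨‹_›, U, hy', hU, hfU, H, hH⟩).symm
  exact (continuousAt_const.congr
    (eventuallyEq_of_mem (hU.mem_nhds hyU) hconst)).continuousWithinAt

end Covering

section PolynomialNonvanishing

open AffineMap MvPolynomial Topology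

variable {ι κ : Type*}

theorem exists_aeval_lineMap_eq (p : MvPolynomial ι ℂ) (x y : ι → ℂ) :
    ∃ q : Polynomial ℂ, ∀ t, aeval (lineMap x y t) p = Polynomial.aeval t q := by
  let ℓ : ι → Polynomial ℂ := fun i => Polynomial.X * Polynomial.C (y i - x i) + Polynomial.C (x i)
  refine ⟨aeval ℓ p, fun t => ?_⟩
  have hℓ : lineMap x y t = fun i => Polynomial.aeval t (ℓ i) := by
    ext i
    simp [ℓ, lineMap_apply]
  rw [hℓ]
  exact (comp_aeval_apply (f := ℓ) (Polynomial.aeval t) p).symm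

theorem finite_setOf_aeval_lineMap_eq_zero {p : MvPolynomial ι ℂ} {x y : ι → ℂ}
    (hy : aeval y p ≠ 0) : {t : ℂ | aeval (lineMap x y t) p = 0}.Finite := by
  obtain ⟨q, hq⟩ := exists_aeval_lineMap_eq p x y
  have hq0 : q ≠ 0 := by
    rintro rfl
    exact hy (by simpa using hq 1)
  simpa only [hq, Polynomial.coe_aeval_eq_eval, Polynomial.IsRoot.def] using
    Polynomial.finite_setOfPred_isRoot hq0

theorem isPreconnected_setOf_aeval_ne_zero (p : MvPolynomial ι ℂ) :
    IsPreconnected {x : ι → ℂ | aeval x p ≠ 0} := by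
  refine isPreconnected_of_forall_pair fun x hx y hy => ?_
  have hline : Continuous (lineMap x y : ℂ → ι → ℂ) := lineMap_continuous
  refine ⟨lineMap x y '' {t : ℂ | aeval (lineMap x y t) p = 0}ᶜ, ?_, ⟨0, ?_⟩, ⟨1, ?_⟩, ?_⟩
  · rintro _ ⟨t, ht, rfl⟩
    exact ht
  · simpa using hx
  · simpa using hy
  · exact ((finite_setOf_aeval_lineMap_eq_zero hy).countable.isConnected_compl_of_one_lt_rank
      (Complex.rank_real_complex ▸ Nat.one_lt_ofNat)).isPreconnected.image _ hline.continuousOn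

theorem dense_setOf_aeval_ne_zero {p : MvPolynomial ι ℂ} (hp : p ≠ 0) :
    Dense {x : ι → ℂ | aeval x p ≠ 0} := by
  intro x
  obtain ⟨y, hy⟩ : ∃ y : ι → ℂ, aeval y p ≠ 0 := by
    by_contra! h
    exact hp (MvPolynomial.funext fun y => (h y).trans (map_zero _).symm)
  have hline : Continuous (lineMap x y : ℂ → ι → ℂ) := lineMap_continuous
  have hdense := (finite_setOf_aeval_lineMap_eq_zero (x := x) hy).countable.dense_compl ℂ
  simpa using map_mem_closure hline (hdense 0) fun t ht => ht

theorem exists_ne_zero_aeval_eq_zero_of_card_lt {R : Type*} [CommRing R] [IsDomain R] [Fintype ι]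
    [Fintype κ] (h : Fintype.card κ < Fintype.card ι) (v : ι → MvPolynomial κ R) :
    ∃ p : MvPolynomial ι R, p ≠ 0 ∧ aeval v p = 0 := by
  by_contra! hv
  have hindep : AlgebraicIndependent R v :=
    algebraicIndependent_iff.2 fun p hp => not_imp_not.1 (hv p) hp
  have hcard := hindep.lift_cardinalMk_le_trdeg
  rw [MvPolynomial.trdeg_of_isDomain] at hcard
  simp only [Cardinal.mk_fintype, Cardinal.lift_natCast, Nat.cast_le] at hcard
  exact h.not_ge hcard

end PolynomialNonvanishing

section Counting

open Filter Function Set Topology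

theorem injective_fderiv_fst_prodMk {𝕜 E F G : Type*} [NontriviallyNormedField 𝕜]
    [NormedAddCommGroup E] [NormedSpace 𝕜 E] [NormedAddCommGroup F] [NormedSpace 𝕜 F]
    [NormedAddCommGroup G] [NormedSpace 𝕜 G] {f : E × F → G} {q : E × F}
    (hf : DifferentiableAt 𝕜 f q) (hinj : Injective (fderiv 𝕜 (fun z => f (q.1, z)) q.2)) :
    Injective (fderiv 𝕜 (fun q => (q.1, f q)) q) := by
  have hpartial : fderiv 𝕜 (fun z => f (q.1, z)) q.2 = (fderiv 𝕜 f q).comp (.inr 𝕜 E F) :=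
    (hf.hasFDerivAt.comp q.2 (hasFDerivAt_prodMk_right q.1 q.2)).fderiv
  have htotal : fderiv 𝕜 (fun q => (q.1, f q)) q =
      (ContinuousLinearMap.fst 𝕜 E F).prod (fderiv 𝕜 f q) :=
    (hasFDerivAt_fst.prodMk hf.hasFDerivAt).fderiv
  rw [hpartial, injective_iff_map_eq_zero] at hinj
  rw [htotal, injective_iff_map_eq_zero]
  rintro ⟨u, v⟩ h
  obtain ⟨rfl, hv⟩ := Prod.mk.inj h
  exact Prod.ext rfl (hinj v hv)

variable {J : ℕ}

/-- The weighted power sum map, with the weights carried along as parameters. -/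
def powerSumFamily (q : (Fin J → ℂ) × (Fin J → ℂ)) : (Fin J → ℂ) × (Fin J → ℂ) :=
  (q.1, powerSumMap q.1 q.2)

variable (J) in
/-- The pairs `(b, a)` of nondegenerate weights `b` and values `a` which `powerSumMap b` takes at
tuples of distinct points only. -/
def regularPairs : Set ((Fin J → ℂ) × (Fin J → ℂ)) :=
  {q | NondegenerateWeights q.1 ∧ ∀ Z, powerSumMap q.1 Z = q.2 → Injective Z}

theorem contDiff_powerSumFamily : ContDiff ℂ 1 (powerSumFamily (J := J)) :=
  contDiff_fst.prodMk contDiff_uncurry_powerSumMap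

theorem isLocalHomeomorphOn_powerSumFamily :
    IsLocalHomeomorphOn (powerSumFamily (J := J)) (powerSumFamily ⁻¹' regularPairs J) := by
  rintro ⟨b, Z⟩ ⟨hb, hZ⟩
  refine exists_openPartialHomeomorph_of_injective_fderiv (𝕜 := ℂ) contDiff_powerSumFamily
    (injective_fderiv_fst_prodMk (f := uncurry powerSumMap) ?_ ?_)
  · exact contDiff_uncurry_powerSumMap.differentiable one_ne_zero _
  · exact (injective_fderiv_powerSumMap_iff hb.ne_zero).2 (hZ Z rfl)

theorem isOpen_setOf_nondegenerateWeights {ι : Type*} [Finite ι] :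
    IsOpen {b : ι → ℂ | NondegenerateWeights b} := by
  simp only [NondegenerateWeights, ofPred_forall]
  exact isOpen_iInter_of_finite fun I => isOpen_iInter_of_finite fun _ =>
    isOpen_ne_fun (by fun_prop) continuous_const

theorem exists_isCompact_eventually_preimage_powerSumFamily_subset
    {q : (Fin J → ℂ) × (Fin J → ℂ)} (hq : NondegenerateWeights q.1) :
    ∃ K, IsCompact K ∧ ∀ᶠ q' in 𝓝 q, powerSumFamily ⁻¹' {q'} ⊆ K := by
  obtain ⟨c, hc, hev⟩ := exists_eventually_mul_min_le_norm_powerSumMap hq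
  refine ⟨Metric.closedBall q.1 1 ×ˢ Metric.closedBall 0 (max 1 ((‖q.2‖ + 1) / c)),
    (isCompact_closedBall _ _).prod (isCompact_closedBall _ _), ?_⟩
  have hweights := (hev.and (Metric.closedBall_mem_nhds q.1 one_pos)).prod_inl_nhds q.2
  have hvalues : ∀ᶠ q' : (Fin J → ℂ) × (Fin J → ℂ) in 𝓝 q, ‖q'.2‖ ≤ ‖q.2‖ + 1 :=
    (continuous_snd.norm.tendsto q).eventually_le_const (lt_add_one _)
  filter_upwards [hweights, hvalues]
  rintro _ ⟨hbound, hball⟩ hle ⟨b, Z⟩ rfl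
  exact ⟨hball, mem_closedBall_zero_iff.2 (norm_le_max_of_mul_min_le hc ((hbound Z).trans hle))⟩

theorem isCoveringMapOn_powerSumFamily :
    IsCoveringMapOn (powerSumFamily (J := J)) (regularPairs J) :=
  isCoveringMapOn_of_isLocalHomeomorphOn (isOpen_setOf_nondegenerateWeights.preimage continuous_fst)
    contDiff_powerSumFamily.continuous
    (fun _ => exists_isCompact_eventually_preimage_powerSumFamily_subset) (fun _ hq => hq.1)
    isLocalHomeomorphOn_powerSumFamily

/-- The weights and power sums with `Z i = Z j` are `2 * J` polynomials in `2 * J - 1` variables. -/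
theorem exists_aeval_powerSumMap_eq_zero_of_ne {i j : Fin J} (hij : i ≠ j) :
    ∃ p : MvPolynomial (Fin J ⊕ Fin J) ℂ, p ≠ 0 ∧ ∀ b Z : Fin J → ℂ, Z i = Z j →
      MvPolynomial.aeval (Sum.elim b (powerSumMap b Z)) p = 0 := by
  let r : Fin J → {k // k ≠ i} := fun k => if hk : k = i then ⟨j, hij.symm⟩ else ⟨k, hk⟩
  let B : Fin J → MvPolynomial (Fin J ⊕ {k // k ≠ i}) ℂ := MvPolynomial.X ∘ Sum.inl
  let W : Fin J → MvPolynomial (Fin J ⊕ {k // k ≠ i}) ℂ := MvPolynomial.X ∘ Sum.inr ∘ r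
  have hcard : Fintype.card (Fin J ⊕ {k // k ≠ i}) < Fintype.card (Fin J ⊕ Fin J) := by
    simpa only [Fintype.card_sum, add_lt_add_iff_left] using
      Fintype.card_subtype_lt (p := (· ≠ i)) (x := i) (not_not.2 rfl)
  obtain ⟨p, hp, hpBW⟩ :=
    exists_ne_zero_aeval_eq_zero_of_card_lt hcard (Sum.elim B (powerSumMap B W))
  refine ⟨p, hp, fun b Z hZ => ?_⟩
  let φ : MvPolynomial (Fin J ⊕ {k // k ≠ i}) ℂ →ₐ[ℂ] ℂ :=
    MvPolynomial.aeval (Sum.elim b fun k => Z k)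
  have hB : φ ∘ B = b := funext fun k => by simp [φ, B]
  have hW : φ ∘ W = Z := funext fun k => by
    by_cases hk : k = i <;> simp [φ, W, r, hk, hZ]
  have hφ : φ ∘ Sum.elim B (powerSumMap B W) = Sum.elim b (powerSumMap b Z) := by
    rw [Sum.comp_elim, hB]
    exact congrArg _ ((map_powerSumMap φ.toRingHom B W).trans (congrArg₂ powerSumMap hB hW))
  rw [← hφ]
  exact (MvPolynomial.comp_aeval_apply _ φ p).symm.trans ((congrArg φ hpBW).trans (map_zero φ))

theorem exists_aeval_powerSumMap_eq_zero_of_mem_partialDiagonals (J : ℕ) :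
    ∃ p : MvPolynomial (Fin J ⊕ Fin J) ℂ, p ≠ 0 ∧ ∀ b, ∀ Z ∈ partialDiagonals J,
      MvPolynomial.aeval (Sum.elim b (powerSumMap b Z)) p = 0 := by
  choose p hp hpZ using fun ij : {ij : Fin J × Fin J // ij.1 ≠ ij.2} =>
    exists_aeval_powerSumMap_eq_zero_of_ne ij.2
  refine ⟨∏ ij, p ij, Finset.prod_ne_zero_iff.2 fun ij _ => hp ij, ?_⟩
  rintro b Z ⟨i, j, hij, hZ⟩
  rw [map_prod]
  exact Finset.prod_eq_zero (Finset.mem_univ ⟨(i, j), hij⟩) (hpZ _ b Z hZ)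

theorem exists_aeval_eq_zero_of_not_nondegenerateWeights (J : ℕ) :
    ∃ p : MvPolynomial (Fin J ⊕ Fin J) ℂ, p ≠ 0 ∧ ∀ b a : Fin J → ℂ, ¬ NondegenerateWeights b →
      MvPolynomial.aeval (Sum.elim b a) p = 0 := by
  refine ⟨∏ I : {I : Finset (Fin J) // I.Nonempty}, ∑ i ∈ I.1, MvPolynomial.X (.inl i),
    Finset.prod_ne_zero_iff.2 fun I _ h => ?_, fun b a hb => ?_⟩
  · have hcard : (I.1.card : ℂ) = 0 := by
      simpa using congrArg (MvPolynomial.aeval fun _ => (1 : ℂ)) h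
    exact I.2.card_ne_zero (by exact_mod_cast hcard)
  · simp only [NondegenerateWeights, not_forall, not_not] at hb
    obtain ⟨I, hI, hbI⟩ := hb
    rw [map_prod]
    exact Finset.prod_eq_zero (Finset.mem_univ ⟨I, hI⟩) (by simpa using hbI)

theorem isPreconnected_regularPairs : IsPreconnected (regularPairs J) := by
  obtain ⟨p, hp, hpdiag⟩ := exists_aeval_powerSumMap_eq_zero_of_mem_partialDiagonals J
  obtain ⟨p', hp', hpdeg⟩ := exists_aeval_eq_zero_of_not_nondegenerateWeights J
  let e := (Homeomorph.sumArrowHomeomorphProdArrow (ι := Fin J) (ι' := Fin J) (X := ℂ)).symm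
  let U := {x : Fin J ⊕ Fin J → ℂ | MvPolynomial.aeval x (p * p') ≠ 0}
  have hU : e ⁻¹' U ⊆ regularPairs J := by
    rintro ⟨b, a⟩ hq
    obtain ⟨hq, hq'⟩ := mul_ne_zero_iff.1 ((map_mul _ p p').symm.trans_ne hq)
    refine ⟨not_imp_comm.1 (hpdeg b a) hq', fun Z hZ => ?_⟩
    obtain rfl : powerSumMap b Z = a := hZ
    exact notMem_partialDiagonals_iff.1 fun hmem => hq (hpdiag b Z hmem)
  have hdense : Dense (e ⁻¹' U) :=
    (dense_setOf_aeval_ne_zero (mul_ne_zero hp hp')).preimage e.isOpenMap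
  exact (e.isPreconnected_preimage.2 (isPreconnected_setOf_aeval_ne_zero _)).subset_closure hU
    fun q _ => hdense q

end Counting

section Sheets

open Function MvPolynomial

variable {J : ℕ}

section Vieta

variable {R : Type*} [CommRing R]

theorem aeval_psum_eq_powerSumMap_one (Z : Fin J → R) (k : Fin J) :
    aeval Z (psum (Fin J) R (k + 1)) = powerSumMap 1 Z k := by
  simp [psum, powerSumMap, powerSum]

theorem powerSumMap_one_comp_perm (Z : Fin J → R) (σ : Equiv.Perm (Fin J)) :
    powerSumMap 1 (Z ∘ σ) = powerSumMap 1 Z :=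
  funext fun k => Equiv.sum_comp σ fun i => 1 * Z i ^ ((k : ℕ) + 1)

variable [IsDomain R] [CharZero R] {Z W : Fin J → R}

theorem aeval_esymm_eq_of_powerSumMap_one_eq (h : powerSumMap 1 Z = powerSumMap 1 W) {n : ℕ}
    (hn : n ≤ J) : aeval Z (esymm (Fin J) R n) = aeval W (esymm (Fin J) R n) := by
  induction n using Nat.strong_induction_on with
  | _ n ih =>
    rcases n.eq_zero_or_pos with rfl | hpos
    · simp only [esymm_zero, map_one]
    refine mul_left_cancel₀ (Nat.cast_ne_zero.2 hpos.ne' : (n : R) ≠ 0) ?_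
    have hnewton (V : Fin J → R) := congrArg (aeval V) (mul_esymm_eq_sum (Fin J) R n)
    simp only [map_mul, map_natCast, map_sum, map_pow, map_neg, map_one] at hnewton
    rw [hnewton, hnewton]
    refine congrArg _ (Finset.sum_congr rfl fun a ha => ?_)
    obtain ⟨hadd, hlt⟩ := Finset.mem_filter.1 ha
    rw [Finset.HasAntidiagonal.mem_antidiagonal] at hadd
    obtain ⟨k, hk⟩ : ∃ k : Fin J, a.2 = k + 1 := ⟨⟨a.2 - 1, by omega⟩, by simp only; omega⟩
    rw [ih a.1 hlt (by omega), hk, aeval_psum_eq_powerSumMap_one, aeval_psum_eq_powerSumMap_one, h]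

theorem map_univ_val_eq_of_powerSumMap_one_eq (h : powerSumMap 1 Z = powerSumMap 1 W) :
    Finset.univ.val.map Z = Finset.univ.val.map W := by
  rw [← Polynomial.roots_multiset_prod_X_sub_C (Finset.univ.val.map Z),
    ← Polynomial.roots_multiset_prod_X_sub_C (Finset.univ.val.map W),
    Multiset.prod_X_sub_X_eq_sum_esymm, Multiset.prod_X_sub_X_eq_sum_esymm]
  simp only [Multiset.card_map, Finset.card_val, Finset.card_univ, Fintype.card_fin,
    ← aeval_esymm_eq_multiset_esymm (Fin J) R]
  refine congrArg _ (Finset.sum_congr rfl fun n hn => ?_)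
  rw [aeval_esymm_eq_of_powerSumMap_one_eq h (Finset.mem_range_succ_iff.1 hn)]

theorem preimage_powerSumMap_one_singleton (hZ : Injective Z) :
    powerSumMap 1 ⁻¹' {powerSumMap 1 Z} = Set.range fun σ : Equiv.Perm (Fin J) => Z ∘ σ := by
  refine Set.Subset.antisymm (fun W hW => ?_) ?_
  · have hmap := map_univ_val_eq_of_powerSumMap_one_eq hW.symm
    have hsurj (i) : ∃ j, W j = Z i := by
      obtain ⟨j, -, hj⟩ := Multiset.mem_map.1
        (hmap ▸ Multiset.mem_map_of_mem Z (Finset.mem_univ_val i))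
      exact ⟨j, hj⟩
    choose τ hτ using hsurj
    have hτ_inj : Injective τ := fun i j hij => hZ (by rw [← hτ, hij, hτ])
    let σ := Equiv.ofBijective τ (Finite.injective_iff_bijective.1 hτ_inj)
    exact ⟨σ.symm, funext fun j => (hτ _).symm.trans (congrArg W (σ.apply_symm_apply j))⟩
  · rintro _ ⟨σ, rfl⟩
    exact powerSumMap_one_comp_perm Z σ

theorem ncard_preimage_powerSumMap_one (hZ : Injective Z) :
    (powerSumMap 1 ⁻¹' {powerSumMap 1 Z}).ncard = J.factorial := by
  have hinj : Injective fun σ : Equiv.Perm (Fin J) => Z ∘ σ := fun σ τ h =>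
    Equiv.ext fun i => hZ (congrFun h i)
  rw [preimage_powerSumMap_one_singleton hZ, ← Set.image_univ, Set.ncard_image_of_injective _ hinj,
    Set.ncard_univ, Nat.card_perm, Nat.card_fin]

end Vieta

theorem nondegenerateWeights_one : NondegenerateWeights (1 : Fin J → ℂ) := fun I hI => by
  simpa using hI.ne_empty

theorem mk_powerSumMap_one_mem_regularPairs {Z : Fin J → ℂ} (hZ : Injective Z) :
    (1, powerSumMap 1 Z) ∈ regularPairs J := by
  refine ⟨nondegenerateWeights_one, fun W hW => ?_⟩
  have hmem : W ∈ powerSumMap 1 ⁻¹' {powerSumMap 1 Z} := hW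
  rw [preimage_powerSumMap_one_singleton hZ] at hmem
  obtain ⟨σ, rfl⟩ := hmem
  exact hZ.comp σ.injective

theorem ncard_preimage_powerSumFamily (b a : Fin J → ℂ) :
    (powerSumFamily ⁻¹' {(b, a)}).ncard = (powerSumMap b ⁻¹' {a}).ncard := by
  rw [← Set.ncard_image_of_injective (powerSumMap b ⁻¹' {a}) (Prod.mk_right_injective b)]
  congr 1
  ext ⟨b', Z⟩
  simp only [powerSumFamily, Set.mem_preimage, Set.mem_singleton_iff, Prod.mk.injEq, Set.mem_image]
  constructor
  · rintro ⟨rfl, h⟩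
    exact ⟨Z, h, rfl, rfl⟩
  · rintro ⟨_, h, rfl, rfl⟩
    exact ⟨rfl, h⟩

theorem ncard_preimage_powerSumMap {b a : Fin J → ℂ} (h : (b, a) ∈ regularPairs J) :
    (powerSumMap b ⁻¹' {a}).ncard = J.factorial := by
  let Z : Fin J → ℂ := fun i => i
  have hZ : Injective Z := Nat.cast_injective.comp Fin.val_injective
  rw [← ncard_preimage_powerSumFamily, ncard_fiber_eq_of_isCoveringMapOn
    isCoveringMapOn_powerSumFamily isPreconnected_regularPairs h
    (mk_powerSumMap_one_mem_regularPairs hZ), ncard_preimage_powerSumFamily,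
    ncard_preimage_powerSumMap_one hZ]

theorem preimage_coeffMap_compl_discriminantLocus_subset (b : Fin J → ℝ) :
    coeffMap b ⁻¹' (discriminantLocus b)ᶜ ⊆ {Z | Injective Z} := fun Z hZ =>
  notMem_partialDiagonals_iff.1 fun hdiag => hZ ⟨Z, hdiag, rfl⟩

theorem ncard_preimage_coeffMap {b : Fin J → ℝ} (hb : NondegenerateWeights b) {A : Fin J → ℂ}
    (hA : A ∉ discriminantLocus b) : (coeffMap b ⁻¹' {A}).ncard = J.factorial := by
  let a := (newtonHomeomorph J).symm A
  have hfiber : coeffMap b ⁻¹' {A} = powerSumMap (Complex.ofReal ∘ b) ⁻¹' {a} := by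
    ext Z
    rw [coeffMap_eq_comp]
    exact (newtonHomeomorph J).toEquiv.eq_symm_apply.symm
  rw [hfiber]
  refine ncard_preimage_powerSumMap ⟨hb.ofReal, fun Z hZ =>
    preimage_coeffMap_compl_discriminantLocus_subset b ?_⟩
  rwa [Set.mem_preimage, show coeffMap b Z = A from hfiber.symm.subset hZ]

theorem isCoveringMap_restrictPreimage_coeffMap {b : Fin J → ℝ} (hb : NondegenerateWeights b) :
    IsCoveringMap ((discriminantLocus b)ᶜ.restrictPreimage (coeffMap b)) := by
  have hlocal : IsLocalHomeomorphOn (coeffMap b) (coeffMap b ⁻¹' (discriminantLocus b)ᶜ) :=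
    fun Z hZ => exists_openPartialHomeomorph_of_injective_fderiv (contDiff_coeffMap b)
      ((injective_fderiv_coeffMap_iff hb.ne_zero).2
        (preimage_coeffMap_compl_discriminantLocus_subset b hZ))
  exact (isCoveringMapOn_of_isProperMap (isProperMap_coeffMap hb)
    hlocal).isCoveringMap_restrictPreimage

end Sheets

/-! ### Differentiability of the potential at the origin -/

section Potential

open Asymptotics Filter Topology

variable {J : ℕ}

theorem newtonInv_zero {R : Type*} [CommRing R] : newtonInv (0 : Fin J → R) = 0 :=
  funext fun k => newtonInv_eq (p := 0) (d := Pi.single 0 1) (by simp)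
    (fun n _ => by simp [NewtonIdentity]) k

theorem newtonInv_apply {R : Type*} [CommRing R] (A : Fin J → R) (k : Fin J) :
    newtonInv A k = -((k + 1) * A k) -
      ∑ j : Fin k, newtonInv A ⟨j, j.2.trans k.2⟩ * A ⟨k - 1 - j, by omega⟩ := by
  have hcons (n : ℕ) (hn : n < J) : consOne A (n + 1) = A ⟨n, hn⟩ :=
    Fin.val_injective.extend_apply A 0 ⟨n, hn⟩
  rw [newtonInv, newtonSum, hcons k k.2]
  congr 1
  refine Finset.sum_congr rfl fun j _ => ?_
  rw [show (k : ℕ) - j = k - 1 - j + 1 by omega, hcons _ (by omega), newtonInv]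

theorem hasFDerivAt_newtonInv_zero :
    HasFDerivAt (newtonInv : (Fin J → ℂ) → Fin J → ℂ)
      (ContinuousLinearMap.pi fun k : Fin J =>
        -((k + 1 : ℂ) • ContinuousLinearMap.proj (R := ℂ) (φ := fun _ : Fin J => ℂ) k)) 0 := by
  have hproj (k : Fin J) : HasFDerivAt (fun A : Fin J → ℂ => A k)
      (ContinuousLinearMap.proj (R := ℂ) (φ := fun _ : Fin J => ℂ) k) 0 := hasFDerivAt_apply k 0
  have hmul (j k : Fin J) : HasFDerivAt (fun A : Fin J → ℂ => newtonInv A j * A k)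
      (0 : (Fin J → ℂ) →L[ℂ] ℂ) 0 := by
    have hj := (differentiable_pi.1 (contDiff_newtonInv.differentiable one_ne_zero) j
      (0 : Fin J → ℂ)).hasFDerivAt
    refine (hj.fun_mul (hproj k)).congr_fderiv (ContinuousLinearMap.ext fun A => ?_)
    simp [newtonInv_zero]
  refine hasFDerivAt_pi.2 fun k => ?_
  simp only [newtonInv_apply (k := k)]
  simpa only [Finset.sum_const_zero, sub_zero] using
    ((hproj k).const_mul (k + 1 : ℂ)).fun_neg.fun_sub (HasFDerivAt.fun_sum fun _ _ => hmul _ _)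

theorem newtonInv_isBigO_id : (newtonInv : (Fin J → ℂ) → Fin J → ℂ) =O[𝓝 0] fun A => A :=
  hasFDerivAt_newtonInv_zero.isBigO_sub.congr (by simp [newtonInv_zero]) (by simp)

theorem norm_pow_succ_le (Z : Fin J → ℂ) (hZ : ‖Z‖ ≤ 1) :
    ‖Z‖ ^ (J + 1) ≤ ‖Z‖ * min ‖Z‖ (‖Z‖ ^ J) := by
  rcases J.eq_zero_or_pos with rfl | hJ
  · rw [Subsingleton.elim Z 0, norm_zero, zero_add, pow_one, zero_mul]
  · rw [min_eq_right (pow_le_of_le_one (norm_nonneg Z) hZ hJ.ne'), pow_succ']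

theorem norm_pow_succ_isLittleO_powerSumMap {b : Fin J → ℂ} (hb : NondegenerateWeights b) :
    (fun Z : Fin J → ℂ => ‖Z‖ ^ (J + 1)) =o[𝓝 0] powerSumMap b := by
  obtain ⟨c, hc, hev⟩ := exists_eventually_mul_min_le_norm_powerSumMap hb
  have hO : (fun Z : Fin J → ℂ => ‖Z‖ ^ (J + 1)) =O[𝓝 0] fun Z => ‖Z‖ * ‖powerSumMap b Z‖ := by
    refine IsBigO.of_bound c⁻¹ ?_
    filter_upwards [Metric.closedBall_mem_nhds (0 : Fin J → ℂ) one_pos] with Z hZ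
    rw [norm_pow, norm_norm, norm_mul, norm_norm, norm_norm, le_inv_mul_iff₀ hc]
    calc c * ‖Z‖ ^ (J + 1) ≤ c * (‖Z‖ * min ‖Z‖ (‖Z‖ ^ J)) := by
          gcongr
          exact norm_pow_succ_le Z (mem_closedBall_zero_iff.1 hZ)
      _ = ‖Z‖ * (c * min ‖Z‖ (‖Z‖ ^ J)) := mul_left_comm _ _ _
      _ ≤ ‖Z‖ * ‖powerSumMap b Z‖ := by
          gcongr
          exact hev.self_of_nhds Z
  have ho : (fun Z : Fin J → ℂ => ‖Z‖) =o[𝓝 0] fun _ => (1 : ℝ) :=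
    (isLittleO_one_iff ℝ).2 tendsto_norm_zero
  refine isLittleO_norm_right.1 (hO.trans_isLittleO ?_)
  simpa only [one_mul] using ho.mul_isBigO (isBigO_refl (fun Z => ‖powerSumMap b Z‖) (𝓝 0))

/-- The linear form `a ↦ -∑ ℓ, a ℓ z ^ (-(ℓ + 1)) / (ℓ + 1)`. Evaluated at the weighted power sums
of `Z` it gives the terms of order at most `J` of `∑ j, b j * log (1 - Z j / z)`. -/
def logTaylorForm (z : ℂ) : (Fin J → ℂ) →L[ℂ] ℂ :=
  -∑ ℓ : Fin J, (z⁻¹ ^ ((ℓ : ℕ) + 1) / (ℓ + 1)) • ContinuousLinearMap.proj ℓ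

theorem logTaylorForm_apply (z : ℂ) (a : Fin J → ℂ) :
    logTaylorForm z a = -∑ ℓ : Fin J, z⁻¹ ^ ((ℓ : ℕ) + 1) / (ℓ + 1) * a ℓ := by
  simp [logTaylorForm]

theorem logTaylor_succ_neg (n : ℕ) (u : ℂ) :
    Complex.logTaylor (n + 1) (-u) = -∑ k : Fin n, u ^ ((k : ℕ) + 1) / (k + 1) := by
  rw [Complex.logTaylor, Finset.sum_range_succ', Nat.cast_zero, div_zero, add_zero,
    Finset.sum_range, ← Finset.sum_neg_distrib]
  refine Finset.sum_congr rfl fun k _ => ?_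
  rw [pow_succ (-1 : ℂ) ((k : ℕ) + 1), mul_neg_one, neg_mul, ← mul_pow, neg_one_mul, neg_neg,
    neg_div, Nat.cast_succ]

theorem logTaylorForm_powerSumMap (b Z : Fin J → ℂ) (z : ℂ) :
    logTaylorForm z (powerSumMap b Z) =
      ∑ j, b j * Complex.logTaylor (J + 1) (-(Z j * z⁻¹)) := by
  simp only [logTaylorForm_apply, logTaylor_succ_neg, powerSumMap, powerSum, mul_neg,
    Finset.sum_neg_distrib, Finset.mul_sum]
  rw [Finset.sum_comm]
  refine congrArg _ (Finset.sum_congr rfl fun j _ => Finset.sum_congr rfl fun ℓ _ => ?_)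
  rw [mul_pow]
  ring

theorem log_norm_sub {z w : ℂ} (hz : z ≠ 0) (hzw : w ≠ z) :
    Real.log ‖z - w‖ = Real.log ‖z‖ + (Complex.log (1 + -(w * z⁻¹))).re := by
  have hfactor : z - w = z * (1 + -(w * z⁻¹)) := by
    field_simp
    ring
  have hne : 1 + -(w * z⁻¹) ≠ 0 := right_ne_zero_of_mul (hfactor ▸ sub_ne_zero.2 hzw.symm)
  rw [hfactor, norm_mul, Real.log_mul (norm_ne_zero_iff.2 hz) (norm_ne_zero_iff.2 hne),
    Complex.log_re]

theorem log_sub_logTaylor_apply_isBigO (j : Fin J) (z : ℂ) (n : ℕ) :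
    (fun Z : Fin J → ℂ => (Complex.log (1 + -(Z j * z⁻¹)) -
      Complex.logTaylor (n + 1) (-(Z j * z⁻¹))).re) =O[𝓝 0] fun Z => ‖Z‖ ^ (n + 1) := by
  have htendsto : Tendsto (fun Z : Fin J → ℂ => -(Z j * z⁻¹)) (𝓝 0) (𝓝 0) :=
    Continuous.tendsto' (by fun_prop) _ _ (by simp)
  have harg : (fun Z : Fin J → ℂ => -(Z j * z⁻¹)) =O[𝓝 0] fun Z => ‖Z‖ := by
    refine IsBigO.of_bound ‖z⁻¹‖ (Eventually.of_forall fun Z => ?_)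
    rw [norm_neg, norm_mul, norm_norm, mul_comm]
    gcongr
    exact norm_le_pi_norm Z j
  have hre : (fun Z : Fin J → ℂ => (Complex.log (1 + -(Z j * z⁻¹)) -
      Complex.logTaylor (n + 1) (-(Z j * z⁻¹))).re) =O[𝓝 0] fun Z =>
        Complex.log (1 + -(Z j * z⁻¹)) - Complex.logTaylor (n + 1) (-(Z j * z⁻¹)) :=
    isBigO_of_le _ fun Z => Complex.abs_re_le_norm _
  exact hre.trans (((Complex.log_sub_logTaylor_isBigO n).comp_tendsto htendsto).trans
    (harg.pow (n + 1)))

theorem logPotential_sub_logTaylorForm_isBigO (b : Fin J → ℝ) {z : ℂ} (hz : z ≠ 0) :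
    (fun Z => logPotential b Z z - ((∑ j, b j) * Real.log ‖z‖ +
      (logTaylorForm z (powerSumMap (Complex.ofReal ∘ b) Z)).re)) =O[𝓝 0]
    fun Z => ‖Z‖ ^ (J + 1) := by
  have hsum := IsBigO.fun_sum (s := Finset.univ) fun j _ =>
    (log_sub_logTaylor_apply_isBigO j z J).const_mul_left (b j)
  have hne (j) : ∀ᶠ Z : Fin J → ℂ in 𝓝 0, Z j ≠ z :=
    (continuous_apply j).continuousAt.eventually_ne hz.symm
  refine hsum.congr' ?_ .rfl
  filter_upwards [eventually_all.2 hne] with Z hZ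
  simp only [logPotential, logTaylorForm_powerSumMap, log_norm_sub hz (hZ _), Function.comp_apply,
    Complex.re_sum, Complex.re_ofReal_mul, Complex.sub_re, mul_add, mul_sub,
    Finset.sum_add_distrib, Finset.sum_sub_distrib, Finset.sum_mul]
  ring

/-- The real part of `A ↦ ∑ ℓ, A ℓ z ^ (-(ℓ + 1))`: the differential at `A = 0` of the
potential. -/
def potentialDifferential (z : ℂ) : (Fin J → ℂ) →L[ℝ] ℝ :=
  Complex.reCLM.comp ((∑ ℓ : Fin J, z⁻¹ ^ ((ℓ : ℕ) + 1) •
    ContinuousLinearMap.proj (R := ℂ) (φ := fun _ : Fin J => ℂ) ℓ).restrictScalars ℝ)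

theorem potentialDifferential_apply (z : ℂ) (A : Fin J → ℂ) :
    potentialDifferential z A = (∑ ℓ : Fin J, z⁻¹ ^ ((ℓ : ℕ) + 1) * A ℓ).re := by
  simp [potentialDifferential]

theorem hasFDerivAt_re_logTaylorForm_newtonInv (z : ℂ) :
    HasFDerivAt (fun A : Fin J → ℂ => (logTaylorForm z (newtonInv A)).re)
      (potentialDifferential z) 0 := by
  have hform := (logTaylorForm z).hasFDerivAt.comp 0 (hasFDerivAt_newtonInv_zero (J := J))
  convert! Complex.reCLM.hasFDerivAt.comp 0 (hform.restrictScalars ℝ) using 1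
  ext A
  rw [potentialDifferential_apply]
  have hterm (ℓ : Fin J) : (ℓ + 1 : ℂ) ≠ 0 := by exact_mod_cast (ℓ : ℕ).succ_ne_zero
  simp [logTaylorForm_apply, ← mul_assoc, hterm]

theorem tendsto_of_coeffMap_comp_eq {b : Fin J → ℝ} (hb : NondegenerateWeights b)
    {Ω : Set (Fin J → ℂ)} {ζ : (Fin J → ℂ) → Fin J → ℂ} (hζ : ∀ A ∈ Ω, coeffMap b (ζ A) = A) :
    Tendsto ζ (𝓝[Ω] 0) (𝓝 0) := by
  have hfiber : coeffMap b ⁻¹' {0} ⊆ {0} := fun Z hZ => by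
    refine eq_zero_of_powerSumMap_eq_zero hb.ofReal ?_
    rw [← newtonInv_coeffMap, show coeffMap b Z = 0 from hZ, newtonInv_zero]
  have hid : Tendsto (coeffMap b ∘ ζ) (𝓝[Ω] 0) (𝓝 0) :=
    (tendsto_id'.2 nhdsWithin_le_nhds).congr' <|
      eventually_mem_nhdsWithin.mono fun A hA => (hζ A hA).symm
  refine (tendsto_comap_iff.2 hid).mono_right ?_
  refine ((isProperMap_coeffMap hb).isClosedMap.comap_nhds_le).trans ?_
  exact (nhdsSet_mono hfiber).trans nhdsSet_singleton.le

theorem hasFDerivWithinAt_logPotential {b : Fin J → ℝ} (hb : NondegenerateWeights b)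
    {Ω : Set (Fin J → ℂ)} {ζ : (Fin J → ℂ) → Fin J → ℂ} (h0 : 0 ∈ Ω)
    (hζ : ∀ A ∈ Ω, coeffMap b (ζ A) = A) {z : ℂ} (hz : z ≠ 0) :
    HasFDerivWithinAt (fun A => logPotential b (ζ A) z) (potentialDifferential z) Ω 0 := by
  have hremainder := ((logPotential_sub_logTaylorForm_isBigO b hz).trans_isLittleO
    (norm_pow_succ_isLittleO_powerSumMap hb.ofReal)).comp_tendsto
      (tendsto_of_coeffMap_comp_eq hb hζ)
  let main (A : Fin J → ℂ) : ℝ :=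
    (∑ j, b j) * Real.log ‖z‖ + (logTaylorForm z (newtonInv A)).re
  have hmain : HasFDerivWithinAt main (potentialDifferential z) Ω 0 :=
    ((hasFDerivAt_re_logTaylorForm_newtonInv z).const_add _).hasFDerivWithinAt
  have hsub : (fun A => logPotential b (ζ A) z - main A) =o[𝓝[Ω] 0] fun A => A := by
    refine (hremainder.congr' ?_ ?_).trans_isBigO (newtonInv_isBigO_id.mono nhdsWithin_le_nhds)
    · filter_upwards [self_mem_nhdsWithin] with A hA
      simp only [Function.comp_apply, main, ← newtonInv_coeffMap, hζ A hA]
    · filter_upwards [self_mem_nhdsWithin] with A hA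
      rw [Function.comp_apply, ← newtonInv_coeffMap, hζ A hA]
  have hsub_zero : logPotential b (ζ 0) z - main 0 = 0 := by
    obtain ⟨C, hC⟩ := hsub.isBigO.bound
    simpa only [norm_zero, mul_zero, norm_le_zero_iff] using hC.self_of_nhdsWithin h0
  have hsub_deriv : HasFDerivWithinAt (fun A => logPotential b (ζ A) z - main A)
      (0 : (Fin J → ℂ) →L[ℝ] ℝ) Ω 0 :=
    .of_isLittleO (by simpa [hsub_zero] using hsub)
  simpa [Pi.add_def] using hsub_deriv.add hmain

theorem inv_mul_exp_pow (r θ : ℝ) (n : ℕ) :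
    ((r : ℂ) * Complex.exp (θ * Complex.I))⁻¹ ^ n =
      ((r ^ n)⁻¹ : ℝ) * Complex.exp ((-(n * θ) : ℝ) * Complex.I) := by
  rw [mul_inv, mul_pow, ← Complex.exp_neg, ← Complex.exp_nat_mul]
  push_cast
  rw [inv_pow]
  congr 2
  ring

theorem potentialDifferential_single (z : ℂ) (ℓ : Fin J) (c : ℂ) :
    potentialDifferential z (Pi.single ℓ c) = (z⁻¹ ^ ((ℓ : ℕ) + 1) * c).re := by
  simp [potentialDifferential_apply, Pi.single_apply]

theorem potentialDifferential_polar_single_one (r θ : ℝ) (ℓ : Fin J) :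
    potentialDifferential (r * Complex.exp (θ * Complex.I)) (Pi.single ℓ 1) =
      Real.cos (((ℓ : ℕ) + 1 : ℕ) * θ) * (r ^ ((ℓ : ℕ) + 1))⁻¹ := by
  rw [potentialDifferential_single, inv_mul_exp_pow, mul_one, Complex.re_ofReal_mul,
    Complex.exp_ofReal_mul_I_re, Real.cos_neg, mul_comm]

theorem potentialDifferential_polar_single_I (r θ : ℝ) (ℓ : Fin J) :
    potentialDifferential (r * Complex.exp (θ * Complex.I)) (Pi.single ℓ Complex.I) =
      Real.sin (((ℓ : ℕ) + 1 : ℕ) * θ) * (r ^ ((ℓ : ℕ) + 1))⁻¹ := by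
  rw [potentialDifferential_single, inv_mul_exp_pow, Complex.mul_I_re, Complex.im_ofReal_mul,
    Complex.exp_ofReal_mul_I_im, Real.sin_neg]
  ring

end Potential

end WeightedCluster

end

theorem propositionp_general (J : ℕ) (b : Fin J → ℝ)
    (hb : b ∉ WeightedCluster.degenerateWeights J) :
    (∃ I : Ideal (MvPolynomial (Fin J) ℂ), I ≠ ⊥ ∧
      WeightedCluster.discriminantLocus b = MvPolynomial.zeroLocus ℂ I) ∧
    Differentiable ℂ (WeightedCluster.coeffMap b) ∧
    IsProperMap (WeightedCluster.coeffMap b) ∧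
    WeightedCluster.ramificationLocus (WeightedCluster.coeffMap b) =
      WeightedCluster.partialDiagonals J ∧
    WeightedCluster.coeffMap b ''
        WeightedCluster.ramificationLocus (WeightedCluster.coeffMap b) =
      WeightedCluster.discriminantLocus b ∧
    WeightedCluster.coeffMap b ⁻¹' (WeightedCluster.discriminantLocus b)ᶜ ⊆
      {Z | Function.Injective Z} ∧
    IsCoveringMap
      ((WeightedCluster.discriminantLocus b)ᶜ.restrictPreimage (WeightedCluster.coeffMap b)) ∧
    (∀ A ∉ WeightedCluster.discriminantLocus b,
      (WeightedCluster.coeffMap b ⁻¹' {A}).ncard = J.factorial) ∧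
    (∀ (Ω : Set (Fin J → ℂ)) (ζ : (Fin J → ℂ) → (Fin J → ℂ)), 0 ∈ Ω →
      (∀ A ∈ Ω, WeightedCluster.coeffMap b (ζ A) = A) →
      ∀ (r θ : ℝ), 0 < r →
        ∃ L : (Fin J → ℂ) →L[ℝ] ℝ,
          HasFDerivWithinAt
            (fun A => WeightedCluster.logPotential b (ζ A)
              ((r : ℂ) * Complex.exp ((θ : ℂ) * Complex.I))) L Ω 0 ∧
          ∀ ℓ : Fin J,
            L (Pi.single ℓ 1) =
              Real.cos ((((ℓ : ℕ) + 1 : ℕ) : ℝ) * θ) * (r ^ ((ℓ : ℕ) + 1))⁻¹ ∧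
            L (Pi.single ℓ Complex.I) =
              Real.sin ((((ℓ : ℕ) + 1 : ℕ) : ℝ) * θ) * (r ^ ((ℓ : ℕ) + 1))⁻¹) := by
  have hnd := WeightedCluster.nondegenerateWeights_of_notMem hb
  have hram := WeightedCluster.ramificationLocus_coeffMap hnd.ne_zero
  refine ⟨WeightedCluster.exists_discriminantLocus_eq_zeroLocus hnd,
    (WeightedCluster.contDiff_coeffMap b).differentiable one_ne_zero,
    WeightedCluster.isProperMap_coeffMap hnd, hram, by rw [hram]; rfl,
    WeightedCluster.preimage_coeffMap_compl_discriminantLocus_subset b,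
    WeightedCluster.isCoveringMap_restrictPreimage_coeffMap hnd,
    fun A hA => WeightedCluster.ncard_preimage_coeffMap hnd hA,
    fun Ω ζ h0 hζ r θ hr => ?_⟩
  have hz : (r : ℂ) * Complex.exp (θ * Complex.I) ≠ 0 :=
    mul_ne_zero (by exact_mod_cast hr.ne') (Complex.exp_ne_zero _)
  exact ⟨_, WeightedCluster.hasFDerivWithinAt_logPotential hnd h0 hζ hz, fun ℓ =>
    ⟨WeightedCluster.potentialDifferential_polar_single_one r θ ℓ,
      WeightedCluster.potentialDifferential_polar_single_I r θ ℓ⟩⟩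

theorem propositionp (J : ℕ) (b : Fin J → ℝ)
    (hsum : ∑ j, b j = (J : ℝ))
    (hb : b ∉ WeightedCluster.degenerateWeights J) :
    -- the weighted discriminant locus is a proper algebraic subvariety
    (∃ I : Ideal (MvPolynomial (Fin J) ℂ), I ≠ ⊥ ∧
      WeightedCluster.discriminantLocus b = MvPolynomial.zeroLocus ℂ I) ∧
    -- the map is proper and holomorphic
    Differentiable ℂ (WeightedCluster.coeffMap b) ∧
    IsProperMap (WeightedCluster.coeffMap b) ∧
    -- i) it is ramified exactly along the partial diagonals, with the stated branch locus
    WeightedCluster.ramificationLocus (WeightedCluster.coeffMap b) =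
      WeightedCluster.partialDiagonals J ∧
    WeightedCluster.coeffMap b ''
        WeightedCluster.ramificationLocus (WeightedCluster.coeffMap b) =
      WeightedCluster.discriminantLocus b ∧
    -- ii) it is a covering with `J!` sheets over the complement of the discriminant locus,
    -- and the covering space consists of tuples of distinct points
    WeightedCluster.coeffMap b ⁻¹' (WeightedCluster.discriminantLocus b)ᶜ ⊆
      {Z | Function.Injective Z} ∧
    IsCoveringMap
      ((WeightedCluster.discriminantLocus b)ᶜ.restrictPreimage (WeightedCluster.coeffMap b)) ∧
    (∀ A ∉ WeightedCluster.discriminantLocus b,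
      (WeightedCluster.coeffMap b ⁻¹' {A}).ncard = J.factorial) ∧
    -- iii) for every right inverse `ζ` on a set `Ω` containing `0` (a full neighbourhood, or the
    -- domain of a branch together with `0`), the function `v` is differentiable at `0`, and its
    -- differential has the stated components in the coordinates `A_ℓ = e'_ℓ + i e''_ℓ`
    (∀ (Ω : Set (Fin J → ℂ)) (ζ : (Fin J → ℂ) → (Fin J → ℂ)), 0 ∈ Ω →
      (∀ A ∈ Ω, WeightedCluster.coeffMap b (ζ A) = A) →
      ∀ (r θ : ℝ), 0 < r →
        ∃ L : (Fin J → ℂ) →L[ℝ] ℝ,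
          HasFDerivWithinAt
            (fun A => WeightedCluster.logPotential b (ζ A)
              ((r : ℂ) * Complex.exp ((θ : ℂ) * Complex.I))) L Ω 0 ∧
          ∀ ℓ : Fin J,
            L (Pi.single ℓ 1) =
              Real.cos ((((ℓ : ℕ) + 1 : ℕ) : ℝ) * θ) * (r ^ ((ℓ : ℕ) + 1))⁻¹ ∧
            L (Pi.single ℓ Complex.I) =
              Real.sin ((((ℓ : ℕ) + 1 : ℕ) : ℝ) * θ) * (r ^ ((ℓ : ℕ) + 1))⁻¹) :=
  propositionp_general J b hb
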